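/- Let $(X,d)$ be a compact metric space and $f\colon X\to X$ a continuous map. **Chains and decompositions.** For an $f$-invariant set $S\subset X$ and $\delta>0$, a $\delta$-chain of $f|_S$ of length $k\ge1$ from $a$ to $b$ is a sequence $a=x_0,x_1,\dots,x_k=b$ in $S$ with $d(f(x_i),x_{i+1})\le\delta$ for $0\le i<k$; it is a $\delta$-cycle if $x_0=x_k$. Write $x\to y$ if for every $\delta>0$ there is a $\delta$-chain of $f$ from $x$ to $y$; let $CR(f)=\{x\in X\colon x\to x\}$, and let $\mathcal{C}(f)$ (the chain components) be the set of equivalence classes in $CR(f)$ of the relation "$x\to y$ and $y\to x$". For $C\in\mathcal{C}(f)$ and $\delta>0$ let $m(C,\delta)$ be the greatest common divisor of the lengths of all $\delta$-cycles of $f|_C$, and for $x,y\in C$ write $x\sim_{C,\delta}y$ if there is a $\delta$-chain of $f|_C$ from $x$ to $y$ whose length is a multiple of $m(C,\delta)$. Let $\mathcal{D}(C,\delta)$ be the set of equivalence classes of $\sim_{C,\delta}$, and let $\mathcal{D}(C)$ be the set of equivalence classes of $\sim_C$, where $x\sim_C y$ means $x\sim_{C,\delta}y$ for all $\delta>0$.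 For $D\in\mathcal{D}(C)$ and $\delta>0$ let $D_\delta$ be the unique element of $\mathcal{D}(C,\delta)$ containing $D$. Put \[ W^s(C)=\{x\in X\colon\lim_{i\to\infty}d(f^i(x),C)=0\},\qquad V^s(D)=\bigcap_{\delta>0}\{x\in W^s(C)\colon\lim_{i\to\infty}d(f^i(x),f^i(D_\delta))=0\}. \] **Tuples and families.** For $n\ge2$, $x_1,\dots,x_n\in X$ and $r>0$ let \[ S_f(x_1,\dots,x_n;r)=\{i\ge0\colon\min_{1\le j<k\le n}d(f^i(x_j),f^i(x_k))>r\}, \] \[ T_f(x_1,\dots,x_n;r)=\{i\ge0\colon\max_{1\le j<k\le n}d(f^i(x_j),f^i(x_k))<r\}. \] The tuple $(x_1,\dots,x_n)$ is $r$-distal for $f$ if $\inf_{i\ge0}\min_{1\le j<k\le n}d(f^i(x_j),f^i(x_k))>r$. For subsets $A$ of $\mathbb{N}_0=\{0,1,2,\dots\}$: $A\in\mathcal{F}_{\rm ud1}$ if $\limsup_{N\to\infty}\frac1N|A\cap\{0,\dots,N-1\}|=1$; $A\in\mathcal{F}_{\rm thick}$ if for every $j\ge1$ there is $i\ge0$ with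 $\{i,i+1,\dots,i+j-1\}\subset A$; $A\in\mathcal{F}_{\rm infinite}$ if $A$ is infinite. **S-limit shadowing.** $f$ has the s-limit shadowing property if for every $\epsilon>0$ there is $\delta>0$ such that for every sequence $(x_i)_{i\ge0}$ in $X$ with $d(f(x_i),x_{i+1})\le\delta$ for all $i\ge0$ and $\lim_{i\to\infty}d(f(x_i),x_{i+1})=0$ there is $x\in X$ with $d(f^i(x),x_i)\le\epsilon$ for all $i\ge0$ and $\lim_{i\to\infty}d(f^i(x),x_i)=0$. **Theorem 1.1.** Let $f\colon X\to X$ be a continuous map with the s-limit shadowing property and let $C\in\mathcal{C}(f)$. Then for every $n\ge2$ the following conditions are equivalent. (1) There are $D\in\mathcal{D}(C)$ and $\delta_n>0$ such that $D^n$ contains a $\delta_n$-distal $n$-tuple for $f$. (1') There is $\delta_n>0$ such that for every $D\in\mathcal{D}(C)$, $D^n$ contains a $\delta_n$-distal $n$-tuple for $f$. (2) There is $\delta_n>0$ such that for every $D\in\mathcal{D}(C)$ the sets \[ \{(x_1,\dots,x_n)\in[V^s(D)]^n\colon S_f(x_1,\dots,x_n;\delta_n)\in\mathcal{F}_{\rm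 ud1}\} \] and \[ \bigcap_{\epsilon>0}\{(x_1,\dots,x_n)\in[V^s(D)]^n\colon T_f(x_1,\dots,x_n;\epsilon)\in\mathcal{F}_{\rm ud1}\} \] are both dense $G_\delta$-subsets of $[V^s(D)]^n$. (3) There are $(y_1,\dots,y_n)\in[W^s(C)]^n$ and $\delta_n>0$ such that $S_f(y_1,\dots,y_n;\delta_n)\in\mathcal{F}_{\rm thick}$ and $T_f(y_1,\dots,y_n;\epsilon)\in\mathcal{F}_{\rm infinite}$ for all $\epsilon>0$. -/

import Mathlib

open Filter Topology

noncomputable section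

namespace SLimit

section Dynamics

variable {X : Type*} [MetricSpace X]

/-- `(x 0, …, x k)` is a `δ`-chain of `f`, with `k > 0`, all of whose points lie in `S`.
For `S = Set.univ` it is a `δ`-chain of `f`; for an `f`-invariant set `S` it is a `δ`-chain of
the restriction `f|_S`. The values `x i` with `i > k` are irrelevant. -/
def IsChainIn (f : X → X) (S : Set X) (δ : ℝ) (k : ℕ) (x : ℕ → X) : Prop :=
  0 < k ∧ (∀ i ≤ k, x i ∈ S) ∧ ∀ i < k, dist (f (x i)) (x (i + 1)) ≤ δ

/-- There is a `δ`-chain of `f|_S` of length `k` from `a` to `b`. -/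
def ChainOfLength (f : X → X) (S : Set X) (δ : ℝ) (k : ℕ) (a b : X) : Prop :=
  ∃ x : ℕ → X, IsChainIn f S δ k x ∧ x 0 = a ∧ x k = b

/-- `a → b`: for every `δ > 0` there is a `δ`-chain of `f` from `a` to `b`. -/
def ChainTo (f : X → X) (a b : X) : Prop :=
  ∀ δ : ℝ, 0 < δ → ∃ k, ChainOfLength f Set.univ δ k a b

/-- The set `CR(f)` of chain recurrent points. -/
def chainRecurrentSet (f : X → X) : Set X := {x | ChainTo f x x}

/-- The set `𝒞(f)` of chain components of `f`: the equivalence classes, in `CR(f)`, of the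
relation `x → y` and `y → x`. -/
def chainComponents (f : X → X) : Set (Set X) :=
  {C | ∃ x ∈ chainRecurrentSet f, C = {y ∈ chainRecurrentSet f | ChainTo f x y ∧ ChainTo f y x}}

/-- `m(C, δ)`: the greatest common divisor of the lengths of all `δ`-cycles of `f|_C`. -/
def cyclePeriod (f : X → X) (C : Set X) (δ : ℝ) : ℕ :=
  Nat.setGcd {k | ∃ a, ChainOfLength f C δ k a a}

/-- The relation `a ∼_{C,δ} b`: there is a `δ`-chain of `f|_C` from `a` to `b` whose length is
a multiple of `m(C, δ)`. -/
def CyclicRel (f : X → X) (C : Set X) (δ : ℝ) (a b : X) : Prop :=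
  ∃ k, cyclePeriod f C δ ∣ k ∧ ChainOfLength f C δ k a b

/-- The `δ`-cyclic decomposition `𝒟(C, δ)`: the set of equivalence classes of `∼_{C,δ}`. -/
def cyclicDecomposition (f : X → X) (C : Set X) (δ : ℝ) : Set (Set X) :=
  {E | ∃ a ∈ C, E = {b ∈ C | CyclicRel f C δ a b}}

/-- The relation `a ∼_C b`: `a ∼_{C,δ} b` for all `δ > 0`. -/
def ChainProximal (f : X → X) (C : Set X) (a b : X) : Prop :=
  ∀ δ : ℝ, 0 < δ → CyclicRel f C δ a b

/-- `𝒟(C)`: the set of equivalence classes of `∼_C` in `C`. -/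
def proximalClasses (f : X → X) (C : Set X) : Set (Set X) :=
  {D | ∃ a ∈ C, D = {b ∈ C | ChainProximal f C a b}}

/-- The basin `W^s(C)`. -/
def basin (f : X → X) (C : Set X) : Set X :=
  {x | Tendsto (fun i : ℕ => Metric.infDist (f^[i] x) C) atTop (𝓝 0)}

/-- `V^s(D)` for `D ∈ 𝒟(C)`: the points `x ∈ W^s(C)` such that `d(f^i(x), f^i(D_δ)) → 0` for
every `δ > 0`, where `D_δ` is the (unique) member of `𝒟(C, δ)` that contains `D`. -/
def stableClass (f : X → X) (C D : Set X) : Set X :=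
  {x ∈ basin f C | ∀ δ : ℝ, 0 < δ → ∃ E ∈ cyclicDecomposition f C δ, D ⊆ E ∧
    Tendsto (fun i : ℕ => Metric.infDist (f^[i] x) (f^[i] '' E)) atTop (𝓝 0)}

/-- The sequence `x` is a `δ`-limit-pseudo orbit of `f`. -/
def IsLimitPseudoOrbit (f : X → X) (δ : ℝ) (x : ℕ → X) : Prop :=
  (∀ i, dist (f (x i)) (x (i + 1)) ≤ δ) ∧
    Tendsto (fun i => dist (f (x i)) (x (i + 1))) atTop (𝓝 0)

/-- The sequence `x` is `ε`-limit shadowed by the point `z`. -/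
def IsLimitShadowedBy (f : X → X) (ε : ℝ) (x : ℕ → X) (z : X) : Prop :=
  (∀ i, dist (f^[i] z) (x i) ≤ ε) ∧
    Tendsto (fun i => dist (f^[i] z) (x i)) atTop (𝓝 0)

/-- The s-limit shadowing property. -/
def SLimitShadowing (f : X → X) : Prop :=
  ∀ ε : ℝ, 0 < ε → ∃ δ : ℝ, 0 < δ ∧ ∀ x : ℕ → X, IsLimitPseudoOrbit f δ x → ∃ z, IsLimitShadowedBy f ε x z

/-- `min_{j < k} d(x_j, x_k)`, for a tuple of at least two points. -/
def minDist {n : ℕ} (x : Fin n → X) : ℝ :=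
  ⨅ p : {p : Fin n × Fin n // p.1 < p.2}, dist (x p.1.1) (x p.1.2)

/-- `max_{j < k} d(x_j, x_k)`, for a tuple of at least two points. -/
def maxDist {n : ℕ} (x : Fin n → X) : ℝ :=
  ⨆ p : {p : Fin n × Fin n // p.1 < p.2}, dist (x p.1.1) (x p.1.2)

/-- `S_f(x_1, …, x_n; r)`. -/
def sepSet (f : X → X) {n : ℕ} (x : Fin n → X) (r : ℝ) : Set ℕ :=
  {i | r < minDist fun j => f^[i] (x j)}

/-- `T_f(x_1, …, x_n; r)`. -/
def proxSet (f : X → X) {n : ℕ} (x : Fin n → X) (r : ℝ) : Set ℕ :=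
  {i | maxDist (fun j => f^[i] (x j)) < r}

/-- `x` is a `δ`-distal tuple for `f`: `inf_{i ≥ 0} min_{j < k} d(f^i(x_j), f^i(x_k)) > δ`. -/
def IsDistalTuple (f : X → X) (δ : ℝ) {n : ℕ} (x : Fin n → X) : Prop :=
  δ < ⨅ i : ℕ, minDist fun j => f^[i] (x j)

end Dynamics

/-- The upper density of a set of natural numbers. -/
def upperDensity (A : Set ℕ) : ℝ :=
  limsup (fun n : ℕ => ((A ∩ Set.Iio n).ncard : ℝ) / n) atTop

/-- The family `ℱ_ud1` of sets of upper density one. -/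
def familyUd1 : Set (Set ℕ) := {A | upperDensity A = 1}

/-- The family `ℱ_thick`: sets that contain arbitrarily long blocks of consecutive integers. -/
def familyThick : Set (Set ℕ) := {A | ∀ j ≥ 1, ∃ i, ∀ t < j, i + t ∈ A}

/-- The family `ℱ_infinite` of infinite sets. -/
def familyInfinite : Set (Set ℕ) := {A | A.Infinite}

end SLimit

end

namespace SLimit

/-! ### Chains, chain transitivity of components, and cycle lengths. -/

section Chains

variable {X : Type*} [MetricSpace X] {f : X → X} {S C : Set X} {δ δ' : ℝ} {k l : ℕ} {a b c : X}

/-! A chain component is chain transitive for the restricted map. Hence the lengths of chains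
between two of its points agree modulo the cycle period, and every large length in that residue
class occurs (`ChainTransitiveOn.exists_chain_of_modEq`). So, at any precision, finitely many points
of one proximal class can be steered to prescribed points of that class in one common time.

This turns distality into chaos (`exists_limitPseudoOrbits`, `exists_chaotic_tuple`). Starting from
any tuple in `V^s(D)`, one builds pseudo orbits with errors tending to zero that alternately follow
a distal tuple of `D` and a single point of `D`, each time for much longer than all the time elapsed
before. True orbits shadowing them start near the given tuple, which gives density, and inherit
separation and proximity with upper density one. The switching times are multiples of finer and
finer periods, which keeps the shadowing points in `V^s(D)`. The `G_δ` claims hold because upper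
density one is a countable combination of open conditions.

Conversely, a limit of the tuples seen at the midpoints of longer and longer separated blocks is
distal (`exists_distal_of_thick`). Its points share a proximal class because orbits that are
infinitely often near equivalent points are so at all late times
(`ChainTransitiveOn.rel_of_near_tail`). Limits of iterates along lengths of finer and finer chains
carry distal tuples between classes (`exists_distal_in_proximalClass`). -/

theorem IsChainIn.append {x y : ℕ → X} (hx : IsChainIn f S δ k x) (hy : IsChainIn f S δ l y)
    (h : x k = y 0) :
    ∃ z, IsChainIn f S δ (k + l) z ∧ (∀ i ≤ k, z i = x i) ∧ ∀ i ≤ l, z (k + i) = y i := by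
  have h1 : ∀ i ≤ l, (fun i => if i ≤ k then x i else y (i - k)) (k + i) = y i := by
    intro i hi
    rcases Nat.eq_zero_or_pos i with rfl | hi0
    · simp [h]
    · have : ¬ k + i ≤ k := by omega
      simp [this]
  refine ⟨fun i => if i ≤ k then x i else y (i - k), ⟨by have := hx.1; omega, ?_, ?_⟩, ?_, h1⟩
  · intro i hi
    by_cases hik : i ≤ k
    · simpa [hik] using hx.2.1 i hik
    · simpa [hik] using hy.2.1 (i - k) (by omega)
  · intro i hi
    by_cases hik : i < k
    · have h2 : i ≤ k := hik.le
      have h3 : i + 1 ≤ k := hik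
      simpa [h2, h3] using hx.2.2 i hik
    · obtain ⟨j, rfl⟩ : ∃ j, i = k + j := ⟨i - k, by omega⟩
      rw [h1 j (by omega), add_assoc, h1 (j + 1) (by omega)]
      exact hy.2.2 j (by omega)
  · intro i hi
    simp [hi]

theorem ChainOfLength.pos (h : ChainOfLength f S δ k a b) : 0 < k := by
  obtain ⟨x, hx, -⟩ := h
  exact hx.1

theorem ChainOfLength.left_mem (h : ChainOfLength f S δ k a b) : a ∈ S := by
  obtain ⟨x, hx, rfl, -⟩ := h
  exact hx.2.1 0 (Nat.zero_le _)

theorem ChainOfLength.right_mem (h : ChainOfLength f S δ k a b) : b ∈ S := by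
  obtain ⟨x, hx, -, rfl⟩ := h
  exact hx.2.1 k le_rfl

theorem ChainOfLength.trans (h : ChainOfLength f S δ k a b) (h' : ChainOfLength f S δ l b c) :
    ChainOfLength f S δ (k + l) a c := by
  obtain ⟨x, hx, rfl, rfl⟩ := h
  obtain ⟨y, hy, hy0, rfl⟩ := h'
  obtain ⟨z, hz, hz1, hz2⟩ := hx.append hy hy0.symm
  exact ⟨z, hz, hz1 0 (Nat.zero_le _), hz2 l le_rfl⟩

theorem ChainOfLength.mono (h : ChainOfLength f S δ k a b) (hδ : δ ≤ δ') :
    ChainOfLength f S δ' k a b := by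
  obtain ⟨x, hx, h0, h1⟩ := h
  exact ⟨x, ⟨hx.1, hx.2.1, fun i hi => (hx.2.2 i hi).trans hδ⟩, h0, h1⟩

/-- The prefix of a chain. -/
theorem IsChainIn.prefix_chain {x : ℕ → X} (hx : IsChainIn f S δ k x) {j : ℕ} (hj : 0 < j)
    (hjk : j ≤ k) : ChainOfLength f S δ j (x 0) (x j) :=
  ⟨x, ⟨hj, fun i hi => hx.2.1 i (hi.trans hjk), fun i hi => hx.2.2 i (hi.trans_le hjk)⟩, rfl, rfl⟩

/-- The suffix of a chain. -/
theorem IsChainIn.suffix_chain {x : ℕ → X} (hx : IsChainIn f S δ k x) {j : ℕ} (hj : j < k) :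
    ChainOfLength f S δ (k - j) (x j) (x k) := by
  refine ⟨fun i => x (j + i), ⟨by omega, fun i hi => hx.2.1 _ (by omega), fun i hi => ?_⟩,
    rfl, by simp only []; congr 1; omega⟩
  exact hx.2.2 (j + i) (by omega)

/-- Moving the points of a chain slightly gives a chain. -/
theorem IsChainIn.perturb {x y : ℕ → X} {η η' : ℝ} (hx : IsChainIn f Set.univ δ k x)
    (hy : ∀ i ≤ k, y i ∈ S) (h1 : ∀ i < k, dist (f (y i)) (f (x i)) ≤ η)
    (h2 : ∀ i < k, dist (x (i + 1)) (y (i + 1)) ≤ η') : IsChainIn f S (η + δ + η') k y := by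
  refine ⟨hx.1, hy, fun i hi => ?_⟩
  calc _ ≤ dist (f (y i)) (f (x i)) + dist (f (x i)) (x (i + 1)) + dist (x (i + 1)) (y (i + 1)) :=
        dist_triangle4 _ _ _ _
    _ ≤ _ := by gcongr; exacts [h1 i hi, hx.2.2 i hi, h2 i hi]

/-- Moving the end points of a chain slightly gives a chain. -/
theorem ChainOfLength.perturb_ends {a' b' : X} {η η' : ℝ} (h : ChainOfLength f S δ k a b)
    (ha : a' ∈ S) (hb : b' ∈ S) (h1 : dist (f a') (f a) ≤ η) (h2 : dist b b' ≤ η') :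
    ChainOfLength f S (η + δ + η') k a' b' := by
  obtain ⟨x, hx, rfl, rfl⟩ := h
  have hk := hx.1
  have hη : 0 ≤ η := dist_nonneg.trans h1
  have hη' : 0 ≤ η' := dist_nonneg.trans h2
  refine ⟨fun i => if i = 0 then a' else if i = k then b' else x i, ⟨hk, ?_, ?_⟩, by simp,
    by simp [hk.ne']⟩
  · intro i hi
    dsimp only
    split_ifs
    exacts [ha, hb, hx.2.1 i hi]
  · intro i hi
    have e1 : dist (f (if i = 0 then a' else if i = k then b' else x i)) (f (x i)) ≤ η := by
      by_cases h0 : i = 0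
      · subst h0; simpa using h1
      · simpa [h0, hi.ne] using hη
    have e2 : dist (x (i + 1)) (if i + 1 = 0 then a' else if i + 1 = k then b' else x (i + 1))
        ≤ η' := by
      by_cases h0 : i + 1 = k
      · subst h0; simpa using h2
      · simpa [h0] using hη'
    calc _ ≤ _ := dist_triangle4 _ (f (x i)) (x (i + 1)) _
      _ ≤ _ := by gcongr; exact hx.2.2 i hi

theorem chainOfLength_iterate (hδ : 0 ≤ δ) (hS : Set.MapsTo f S S) (ha : a ∈ S) (hk : 0 < k) :
    ChainOfLength f S δ k a (f^[k] a) := by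
  refine ⟨fun i => f^[i] a, ⟨hk, fun i _ => hS.iterate i ha, fun i _ => ?_⟩, rfl, rfl⟩
  simp only [Function.iterate_succ_apply', dist_self]
  exact hδ

theorem ChainTo.trans (h : ChainTo f a b) (h' : ChainTo f b c) : ChainTo f a c := by
  intro δ hδ
  obtain ⟨k, hk⟩ := h δ hδ
  obtain ⟨l, hl⟩ := h' δ hδ
  exact ⟨k + l, hk.trans hl⟩

theorem chainTo_map (f : X → X) (a : X) : ChainTo f a (f a) := fun _ hδ =>
  ⟨1, chainOfLength_iterate hδ.le (Set.mapsTo_univ _ _) (Set.mem_univ a) one_pos⟩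

/-- The relation `→` is closed. -/
theorem chainTo_of_forall_near (hf : Continuous f)
    (h : ∀ δ > 0, ∃ a' b', dist a' a < δ ∧ dist b' b < δ ∧
      ∃ k, ChainOfLength f Set.univ δ k a' b') : ChainTo f a b := by
  intro δ hδ
  obtain ⟨η, hη, hη'⟩ := Metric.continuous_iff.1 hf a (δ / 3) (by positivity)
  obtain ⟨a', b', ha, hb, k, hk⟩ := h (min η (δ / 3)) (by positivity)
  refine ⟨k, (hk.perturb_ends (η := δ / 3) (η' := δ / 3) (Set.mem_univ a) (Set.mem_univ b)
    ?_ ?_).mono ?_⟩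
  · rw [dist_comm]
    exact (hη' a' (ha.trans_le (min_le_left _ _))).le
  · exact (hb.trans_le (min_le_right _ _)).le
  · have := min_le_right η (δ / 3)
    linarith

/-- If `a → b` and `b → a` then `f a → b`. -/
theorem chainTo_of_map (hf : Continuous f) (h : ChainTo f a b) (h' : ChainTo f b a) :
    ChainTo f (f a) b := by
  refine chainTo_of_forall_near hf fun δ hδ => ?_
  obtain ⟨k, hk⟩ := h (δ / 2) (by positivity)
  obtain ⟨l, hl⟩ := h' (δ / 2) (by positivity)
  -- The detour back through `a` makes the chain longer than one step, so a genuine chain remains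
  -- once its first point is dropped.
  obtain ⟨x, hx, h0, h1⟩ := hk.trans (hl.trans hk)
  have := hk.pos
  refine ⟨x 1, b, ?_, by simpa using hδ, k + (l + k) - 1, ?_⟩
  · have := hx.2.2 0 (by omega)
    rw [h0, dist_comm] at this
    exact lt_of_le_of_lt this (by linarith)
  · rw [← h1]
    exact (hx.suffix_chain (j := 1) (by omega)).mono (by linarith)

/-- A nonempty closed set, mapped into itself, on which the map is chain transitive. -/
structure ChainTransitiveOn (f : X → X) (C : Set X) : Prop where
  isClosed : IsClosed C
  nonempty : C.Nonempty
  mapsTo : Set.MapsTo f C C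
  exists_chain : ∀ δ > 0, ∀ a ∈ C, ∀ b ∈ C, ∃ k, ChainOfLength f C δ k a b

theorem exists_uniform_modulus [CompactSpace X] (hf : Continuous f) (hδ : 0 < δ) :
    ∃ η > 0, η ≤ δ ∧ ∀ a b, dist a b < η → dist (f a) (f b) < δ := by
  obtain ⟨η, hη, h⟩ := Metric.uniformContinuous_iff.1
    (CompactSpace.uniformContinuous_of_continuous hf) δ hδ
  exact ⟨min η δ, by positivity, min_le_right _ _,
    fun a b hab => h (hab.trans_le (min_le_left _ _))⟩

/-- Fine chains between points of `C` may leave `C`, but not far: otherwise points on finer and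
finer chains, all at distance at least `η` from `C`, accumulate at some `w` with `a → w → b`, and
then `w ∈ C`. A chain near `C` can be projected to `C`. -/
theorem chainTransitiveOn_of_mem_chainComponents [CompactSpace X] (hf : Continuous f)
    (hC : C ∈ chainComponents f) : ChainTransitiveOn f C := by
  obtain ⟨x, hx, rfl⟩ := hC
  set C := {y ∈ chainRecurrentSet f | ChainTo f x y ∧ ChainTo f y x} with hCdef
  have mem_iff : ∀ y, y ∈ C ↔ ChainTo f x y ∧ ChainTo f y x := fun y =>
    ⟨fun h => h.2, fun h => ⟨h.2.trans h.1, h⟩⟩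
  have hne : C.Nonempty := ⟨x, (mem_iff x).2 ⟨hx, hx⟩⟩
  have hclosed : IsClosed C := by
    refine isClosed_of_closure_subset fun y hy => (mem_iff y).2 ?_
    rw [Metric.mem_closure_iff] at hy
    constructor <;> refine chainTo_of_forall_near hf fun δ hδ => ?_
    · obtain ⟨z, hz, hyz⟩ := hy δ hδ
      exact ⟨x, z, by simpa using hδ, by rwa [dist_comm], ((mem_iff z).1 hz).1 δ hδ⟩
    · obtain ⟨z, hz, hyz⟩ := hy δ hδ
      exact ⟨z, x, by rwa [dist_comm], by simpa using hδ, ((mem_iff z).1 hz).2 δ hδ⟩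
  have hmaps : Set.MapsTo f C C := fun y hy => by
    rw [mem_iff] at hy ⊢
    exact ⟨hy.1.trans (chainTo_map f y), chainTo_of_map hf hy.2 hy.1⟩
  refine ⟨hclosed, hne, hmaps, fun δ hδ a ha b hb => ?_⟩
  have hab : ChainTo f a b := ((mem_iff a).1 ha).2.trans ((mem_iff b).1 hb).1
  have hba : ChainTo f b a := ((mem_iff b).1 hb).2.trans ((mem_iff a).1 ha).1
  obtain ⟨η, hη, hηδ, hmod⟩ := exists_uniform_modulus hf (δ := δ / 3) (by positivity)
  obtain ⟨δ', hδ', hδ'δ, k, y, hy, hy0, hyk, hnear⟩ : ∃ δ' > 0, δ' ≤ δ / 3 ∧ ∃ k y,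
      IsChainIn f Set.univ δ' k y ∧ y 0 = a ∧ y k = b ∧ ∀ i ≤ k, Metric.infDist (y i) C < η := by
    by_contra! hcon
    have key : ∀ m : ℕ, ∃ z, η ≤ Metric.infDist z C ∧ ∀ δ', min (δ / 3) (1 / (m + 1 : ℝ)) ≤ δ' →
        (∃ k, ChainOfLength f Set.univ δ' k a z) ∧ ∃ k, ChainOfLength f Set.univ δ' k z b := by
      intro m
      have hp : 0 < min (δ / 3) (1 / (m + 1 : ℝ)) := by positivity
      obtain ⟨k, y, hy, hy0, hyk⟩ := hab _ hp
      obtain ⟨i, hi, hiη⟩ := hcon _ hp (min_le_left _ _) k y hy hy0 hyk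
      have hi0 : i ≠ 0 := by
        rintro rfl
        rw [hy0, Metric.infDist_zero_of_mem ha] at hiη
        linarith
      have hik : i ≠ k := by
        rintro rfl
        rw [hyk, Metric.infDist_zero_of_mem hb] at hiη
        linarith
      refine ⟨y i, hiη, fun δ' h => ⟨⟨i, ?_⟩, ⟨k - i, ?_⟩⟩⟩
      · rw [← hy0]
        exact (hy.prefix_chain (by omega) hi).mono h
      · rw [← hyk]
        exact (hy.suffix_chain (by omega)).mono h
    choose z hzη hz using key
    obtain ⟨w, φ, hφ, hw⟩ := CompactSpace.tendsto_subseq z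
    have hnear : ∀ δ' > 0, ∃ m, dist (z m) w < δ' ∧ min (δ / 3) (1 / (m + 1 : ℝ)) ≤ δ' := by
      intro δ' hδ'
      have h1 : ∀ᶠ m in atTop, dist (z (φ m)) w < δ' := hw.eventually (Metric.ball_mem_nhds w hδ')
      have h2 : ∀ᶠ m : ℕ in atTop, 1 / (((φ m : ℕ) : ℝ) + 1) < δ' :=
        (tendsto_one_div_add_atTop_nhds_zero_nat.comp hφ.tendsto_atTop).eventually_lt_const hδ'
      obtain ⟨m, hm1, hm2⟩ := (h1.and h2).exists
      exact ⟨φ m, hm1, (min_le_right _ _).trans hm2.le⟩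
    have haw : ChainTo f a w := chainTo_of_forall_near hf fun δ' hδ' => by
      obtain ⟨m, hm, hm'⟩ := hnear δ' hδ'
      exact ⟨a, z m, by simpa using hδ', hm, (hz m δ' hm').1⟩
    have hwb : ChainTo f w b := chainTo_of_forall_near hf fun δ' hδ' => by
      obtain ⟨m, hm, hm'⟩ := hnear δ' hδ'
      exact ⟨z m, b, hm, by simpa using hδ', (hz m δ' hm').2⟩
    have hwC : w ∈ C := (mem_iff w).2
      ⟨((mem_iff a).1 ha).1.trans haw, hwb.trans ((mem_iff b).1 hb).2⟩
    have hlim : η ≤ Metric.infDist w C := ge_of_tendsto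
      (((Metric.continuous_infDist_pt C).tendsto w).comp hw) (Eventually.of_forall fun m => hzη _)
    rw [Metric.infDist_zero_of_mem hwC] at hlim
    linarith
  -- The projection fixes points already in `C`, so the end points of the chain do not move.
  have hproj : ∀ i, ∃ p ∈ C, (i ≤ k → dist (y i) p < η) ∧ (y i ∈ C → p = y i) := by
    intro i
    by_cases hi : y i ∈ C
    · exact ⟨y i, hi, fun _ => by simpa using hη, fun _ => rfl⟩
    · by_cases hik : i ≤ k
      · obtain ⟨p, hp, hp'⟩ := (Metric.infDist_lt_iff hne).1 (hnear i hik)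
        exact ⟨p, hp, fun _ => hp', fun h => absurd h hi⟩
      · exact ⟨x, (mem_iff x).2 ⟨hx, hx⟩, fun h => absurd h hik, fun h => absurd h hi⟩
  choose p hpC hpη hpy using hproj
  refine ⟨k, ChainOfLength.mono (δ := δ / 3 + δ' + δ / 3) ⟨p, hy.perturb (fun i _ => hpC i)
    (fun i hi => ?_) (fun i hi => ?_), ?_, ?_⟩ (by linarith)⟩
  · exact (hmod _ _ (by rw [dist_comm]; exact hpη i hi.le)).le
  · exact (hpη (i + 1) hi).le.trans hηδ
  · rw [hpy 0 (hy0 ▸ ha), hy0]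
  · rw [hpy k (hyk ▸ hb), hyk]

theorem CyclicRel.trans (h : CyclicRel f C δ a b) (h' : CyclicRel f C δ b c) :
    CyclicRel f C δ a c := by
  obtain ⟨k, hk, h⟩ := h
  obtain ⟨l, hl, h'⟩ := h'
  exact ⟨k + l, dvd_add hk hl, h.trans h'⟩

namespace ChainTransitiveOn

/-- The last step of a fine cycle at `x` shows that `x` is a limit of points of the closed set `f ''
C`. -/
theorem surjOn [CompactSpace X] (hC : ChainTransitiveOn f C) (hf : Continuous f) :
    Set.SurjOn f C C := by
  intro x hx
  have hcl : IsClosed (f '' C) := (hC.isClosed.isCompact.image hf).isClosed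
  rw [← hcl.closure_eq, Metric.mem_closure_iff]
  intro ε hε
  obtain ⟨k, y, hy, hy0, hyk⟩ := hC.exists_chain (ε / 2) (by positivity) x hx x hx
  have hk := hy.1
  refine ⟨f (y (k - 1)), ⟨_, hy.2.1 _ (by omega), rfl⟩, ?_⟩
  have := hy.2.2 (k - 1) (by omega)
  rw [Nat.sub_add_cancel hk, hyk, dist_comm] at this
  linarith

theorem iterate_surjOn [CompactSpace X] (hC : ChainTransitiveOn f C) (hf : Continuous f) (i : ℕ) :
    Set.SurjOn f^[i] C C :=
  (hC.surjOn hf).iterate i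

theorem dvd_of_cycle (h : ChainOfLength f C δ k a a) : cyclePeriod f C δ ∣ k :=
  Nat.setGcd_dvd_of_mem ⟨a, h⟩

theorem cyclePeriod_dvd (h : δ' ≤ δ) : cyclePeriod f C δ ∣ cyclePeriod f C δ' :=
  Nat.setGcd_mono fun _ ⟨a, ha⟩ => ⟨a, ha.mono h⟩

theorem cyclePeriod_pos (hC : ChainTransitiveOn f C) (hδ : 0 < δ) : 0 < cyclePeriod f C δ := by
  obtain ⟨a, ha⟩ := hC.nonempty
  obtain ⟨k, hk⟩ := hC.exists_chain δ hδ a ha a ha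
  exact Nat.pos_of_dvd_of_pos (dvd_of_cycle hk) hk.pos

theorem refl (hC : ChainTransitiveOn f C) (hδ : 0 < δ) (ha : a ∈ C) : CyclicRel f C δ a a := by
  obtain ⟨k, hk⟩ := hC.exists_chain δ hδ a ha a ha
  exact ⟨k, dvd_of_cycle hk, hk⟩

/-- Chains between two given points have the same length modulo the period. -/
theorem modEq_of_chains (hC : ChainTransitiveOn f C) (hδ : 0 < δ) (h : ChainOfLength f C δ k a b)
    (h' : ChainOfLength f C δ l a b) : k ≡ l [MOD cyclePeriod f C δ] := by
  obtain ⟨j, hj⟩ := hC.exists_chain δ hδ b h.right_mem a h.left_mem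
  have h1 := (Nat.modEq_zero_iff_dvd.2 (dvd_of_cycle (h.trans hj)))
  have h2 := (Nat.modEq_zero_iff_dvd.2 (dvd_of_cycle (h'.trans hj)))
  exact Nat.ModEq.add_right_cancel' j (h1.trans h2.symm)

theorem symm (hC : ChainTransitiveOn f C) (hδ : 0 < δ) (h : CyclicRel f C δ a b) :
    CyclicRel f C δ b a := by
  obtain ⟨k, hk, h⟩ := h
  obtain ⟨l, hl⟩ := hC.exists_chain δ hδ b h.right_mem a h.left_mem
  exact ⟨l, (Nat.dvd_add_right hk).1 (dvd_of_cycle (h.trans hl)), hl⟩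

/-- Chains of equal length from equivalent points lead to equivalent points. -/
theorem rel_of_chains (hC : ChainTransitiveOn f C) {a' b' : X} (hδ : 0 < δ)
    (h : CyclicRel f C δ a a') (hb : ChainOfLength f C δ k a b)
    (hb' : ChainOfLength f C δ k a' b') :
    CyclicRel f C δ b b' := by
  obtain ⟨j, hj, h⟩ := h
  obtain ⟨l, hl⟩ := hC.exists_chain δ hδ b hb.right_mem a hb.left_mem
  refine ⟨l + (j + k), ?_, hl.trans (h.trans hb')⟩
  have h1 := dvd_of_cycle (hb.trans hl)
  rw [show l + (j + k) = (k + l) + j by ring]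
  exact dvd_add h1 hj

theorem rel_iterate (hC : ChainTransitiveOn f C) (hδ : 0 < δ) (h : CyclicRel f C δ a b) (i : ℕ) :
    CyclicRel f C δ (f^[i] a) (f^[i] b) := by
  rcases Nat.eq_zero_or_pos i with rfl | hi
  · exact h
  · obtain ⟨_, -, hab⟩ := id h
    exact hC.rel_of_chains hδ h (chainOfLength_iterate hδ.le hC.mapsTo hab.left_mem hi)
      (chainOfLength_iterate hδ.le hC.mapsTo hab.right_mem hi)

/-- Close points are equivalent. -/
theorem exists_rel_of_dist_lt (hC : ChainTransitiveOn f C) [CompactSpace X] (hf : Continuous f)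
    (hδ : 0 < δ) : ∃ η > 0, ∀ a ∈ C, ∀ b ∈ C, dist a b < η → CyclicRel f C δ a b := by
  obtain ⟨η, hη, -, hmod⟩ := exists_uniform_modulus hf (δ := δ / 2) (by positivity)
  refine ⟨η, hη, fun a ha b hb hab => ?_⟩
  -- Moving only the start of a cycle at `b` to `a` gives a chain from `a` to `b` of the same
  -- length, a multiple of the period.
  obtain ⟨k, hk⟩ := hC.exists_chain (δ / 2) (by positivity) b hb b hb
  refine ⟨k, dvd_of_cycle (hk.mono (by linarith)), ?_⟩
  exact (hk.perturb_ends (η' := 0) ha hb (hmod a b hab).le (by simp)).mono (by linarith)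

/-- All large lengths in the right residue class are lengths of chains. -/
theorem exists_chain_of_modEq (hC : ChainTransitiveOn f C) (hδ : 0 < δ)
    (h : ChainOfLength f C δ k a b) : ∃ K, ∀ l ≥ K, l ≡ k [MOD cyclePeriod f C δ] →
      ChainOfLength f C δ l a b := by
  set s := {j | ChainOfLength f C δ j b b} with hs
  -- Cycles at the single point `b` already determine the period: compare a loop from `b` through
  -- `c` with and without the given cycle at `c`.
  have hgcd : cyclePeriod f C δ = Nat.setGcd s := by
    refine Nat.dvd_antisymm (Nat.setGcd_mono fun j hj => ⟨b, hj⟩) ?_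
    refine Nat.dvd_setGcd_iff.2 ?_
    rintro j ⟨c, hc⟩
    obtain ⟨p, hp⟩ := hC.exists_chain δ hδ b h.right_mem c hc.left_mem
    obtain ⟨q, hq⟩ := hC.exists_chain δ hδ c hc.left_mem b h.right_mem
    have h1 : Nat.setGcd s ∣ p + q := Nat.setGcd_dvd_of_mem (hp.trans hq)
    have h2 : Nat.setGcd s ∣ p + (j + q) := Nat.setGcd_dvd_of_mem (hp.trans (hc.trans hq))
    rw [show p + (j + q) = (p + q) + j by ring] at h2
    exact (Nat.dvd_add_right h1).1 h2
  -- A numerical semigroup contains all large multiples of its gcd, and cycle lengths at `b` are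
  -- closed under addition.
  obtain ⟨K, hK⟩ := Nat.exists_mem_closure_of_ge s
  have hcl : ∀ j ∈ AddSubmonoid.closure s, j = 0 ∨ j ∈ s := fun j hj => by
    refine AddSubmonoid.closure_induction (fun _ h => Or.inr h) (Or.inl rfl) ?_ hj
    rintro x y - - (rfl | hx) (rfl | hy)
    · exact Or.inl rfl
    · simpa using Or.inr hy
    · simpa using Or.inr hx
    · exact Or.inr (ChainOfLength.trans hx hy)
  refine ⟨K + k + 1, fun l hl hmod => ?_⟩
  have hdvd : Nat.setGcd s ∣ l - k := hgcd ▸ (Nat.modEq_iff_dvd' (by omega)).1 hmod.symm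
  rcases hcl _ (hK (l - k) (by omega) hdvd) with h0 | h0
  · omega
  · have := h.trans h0
    rwa [Nat.add_sub_cancel' (by omega)] at this

end ChainTransitiveOn

end Chains

/-! ### Upper density one and thick sets. -/

section Density

variable {A B : Set ℕ}

theorem ncard_inter_Iio_le (A : Set ℕ) (N : ℕ) : (A ∩ Set.Iio N).ncard ≤ N := by
  have := Set.ncard_le_ncard (Set.inter_subset_right (s := A) (t := Set.Iio N)) (Set.finite_Iio N)
  simpa using this

theorem mem_familyUd1_iff :
    A ∈ familyUd1 ↔ ∀ c < 1, ∃ᶠ N : ℕ in atTop, c * N < ((A ∩ Set.Iio N).ncard : ℝ) := by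
  have hle : ∀ N : ℕ, ((A ∩ Set.Iio N).ncard : ℝ) / N ≤ 1 := fun N =>
    div_le_one_of_le₀ (by exact_mod_cast ncard_inter_Iio_le A N) (Nat.cast_nonneg N)
  have hbdd : IsBoundedUnder (· ≤ ·) atTop fun N : ℕ => ((A ∩ Set.Iio N).ncard : ℝ) / N :=
    isBoundedUnder_of ⟨1, hle⟩
  have hbdd' : IsBoundedUnder (· ≥ ·) atTop fun N : ℕ => ((A ∩ Set.Iio N).ncard : ℝ) / N :=
    isBoundedUnder_of ⟨0, fun N => by positivity⟩
  have hmul : ∀ c : ℝ, (∃ᶠ N : ℕ in atTop, c * N < ((A ∩ Set.Iio N).ncard : ℝ)) ↔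
      ∃ᶠ N : ℕ in atTop, c < ((A ∩ Set.Iio N).ncard : ℝ) / N := fun c => by
    refine frequently_congr ((eventually_gt_atTop 0).mono fun N hN => ?_)
    rw [lt_div_iff₀ (by exact_mod_cast hN)]
  change limsup (fun N : ℕ => ((A ∩ Set.Iio N).ncard : ℝ) / N) atTop = 1 ↔ _
  constructor
  · intro h c hc
    rw [hmul]
    exact frequently_lt_of_lt_limsup hbdd'.isCoboundedUnder_le (h ▸ hc)
  · intro h
    refine le_antisymm (limsup_le_of_le hbdd'.isCoboundedUnder_le (Eventually.of_forall hle)) ?_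
    refine le_of_forall_lt fun c hc => ?_
    obtain ⟨c', hcc', hc'⟩ := exists_between hc
    exact hcc'.trans_le (le_limsup_of_frequently_le (((hmul c').1 (h c' hc')).mono fun _ => le_of_lt)
      hbdd)

theorem familyUd1_mono (hA : A ∈ familyUd1) (h : A ⊆ B) : B ∈ familyUd1 := by
  rw [mem_familyUd1_iff] at hA ⊢
  refine fun c hc => (hA c hc).mono fun N hN => hN.trans_le ?_
  exact_mod_cast Set.ncard_le_ncard (Set.inter_subset_inter_left _ h)
    ((Set.finite_Iio N).subset Set.inter_subset_right)

/-- A set that contains very long blocks has upper density one. -/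
theorem mem_familyUd1_of_blocks {t L : ℕ → ℕ} (ht : StrictMono t) (hL : ∀ j, j * t j ≤ L j)
    (h : ∃ᶠ j in atTop, ∀ i < L j, t j + i ∈ A) : A ∈ familyUd1 := by
  rw [mem_familyUd1_iff]
  intro c hc
  rw [frequently_atTop]
  intro M
  obtain ⟨j₀, hj₀⟩ := exists_nat_gt (c / (1 - c))
  obtain ⟨j, hj, hblock⟩ := frequently_atTop.1 h (max (M + 1) (j₀ + 1))
  have hjM : M + 1 ≤ j := (le_max_left _ _).trans hj
  have hjj : j₀ + 1 ≤ j := (le_max_right _ _).trans hj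
  have htj : j ≤ t j := ht.id_le j
  -- Up to the end of the block the proportion of `A` is at least `L j / (t j + L j) ≥ j / (j + 1)`,
  -- which exceeds `c` once `j > c / (1 - c)`.
  refine ⟨t j + L j, by omega, ?_⟩
  have hcard : L j ≤ (A ∩ Set.Iio (t j + L j)).ncard := by
    have hsub : (fun i => t j + i) '' Set.Iio (L j) ⊆ A ∩ Set.Iio (t j + L j) := by
      rintro _ ⟨i, hi, rfl⟩
      exact ⟨hblock i hi, by simpa using hi⟩
    have := Set.ncard_le_ncard hsub ((Set.finite_Iio _).subset Set.inter_subset_right)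
    rwa [Set.ncard_image_of_injective _ (add_right_injective _), Set.ncard_eq_toFinset_card',
      Set.toFinset_Iio, Nat.card_Iio] at this
  have hcard' : (L j : ℝ) ≤ ((A ∩ Set.Iio (t j + L j)).ncard : ℝ) := by exact_mod_cast hcard
  refine lt_of_lt_of_le ?_ hcard'
  have h1 : c < (1 - c) * j := by
    have : (j₀ : ℝ) + 1 ≤ j := by exact_mod_cast hjj
    have h2 : c / (1 - c) < j := by linarith
    rwa [div_lt_iff₀ (by linarith), mul_comm] at h2
  have h2 : (j : ℝ) * t j ≤ L j := by exact_mod_cast hL j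
  have h3 : (0 : ℝ) < t j := by
    have : 0 < t j := by omega
    exact_mod_cast this
  have h4 := mul_lt_mul_of_pos_right h1 h3
  have h5 := mul_le_mul_of_nonneg_left h2 (by linarith : 0 ≤ 1 - c)
  push_cast
  linarith

/-- If `A` misses a point of every block of length `j`, counting disjoint blocks bounds its upper
density by `1 - 1 / j`. -/
theorem familyUd1_subset_familyThick : familyUd1 ⊆ familyThick := by
  intro A hA j hj
  by_contra! hcon
  choose s hs hsA using hcon
  have hjR : (0 : ℝ) < j := by exact_mod_cast hj
  obtain ⟨N, hN, hcN⟩ := frequently_atTop.1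
    (mem_familyUd1_iff.1 hA (1 - 1 / (2 * j)) (by
      have : (0 : ℝ) < 1 / (2 * j) := by positivity
      linarith)) (2 * j)
  -- One missing point per block. Since `N ≥ 2 * j`, the number `N / j` of full blocks exceeds half
  -- of the real quotient, contradicting the choice of `1 - 1 / (2 * j)`.
  set g : ℕ → ℕ := fun q => q * j + s (q * j) with hg
  have hginj : Function.Injective g := by
    have : StrictMono g := strictMono_nat_of_lt_succ fun q => by
      have := hs (q * j)
      simp only [hg, add_mul, one_mul]
      omega
    exact this.injective
  have hsub : g '' Set.Iio (N / j) ⊆ Set.Iio N \ (A ∩ Set.Iio N) := by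
    rintro _ ⟨q, hq, rfl⟩
    have h1 : (q + 1) * j ≤ N := (Nat.mul_le_mul_right j (Nat.succ_le_of_lt hq)).trans
      (Nat.div_mul_le_self N j)
    have h2 := hs (q * j)
    refine ⟨?_, fun h => hsA _ h.1⟩
    simp only [Set.mem_Iio, hg]
    rw [add_mul, one_mul] at h1
    omega
  have h1 := Set.ncard_le_ncard hsub ((Set.finite_Iio _).subset Set.sdiff_subset)
  have h2 := Set.ncard_sdiff_add_ncard_of_subset (Set.inter_subset_right (s := A) (t := Set.Iio N))
    (Set.finite_Iio N)
  rw [Set.ncard_image_of_injective _ hginj] at h1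
  simp only [Set.ncard_eq_toFinset_card' (Set.Iio _), Set.toFinset_Iio, Nat.card_Iio] at h1 h2
  have h3 : N < (N / j + 1) * j := by
    rw [add_mul, one_mul]
    exact Nat.lt_div_mul_add hj
  have h4 : (N : ℝ) < ((N / j : ℕ) + 1) * j := by exact_mod_cast h3
  have h5 : ((N / j : ℕ) : ℝ) + ((A ∩ Set.Iio N).ncard : ℝ) ≤ N := by
    exact_mod_cast (by omega : N / j + (A ∩ Set.Iio N).ncard ≤ N)
  have h6 : (2 * j : ℝ) ≤ N := by exact_mod_cast hN
  have h7 : ((N / j : ℕ) : ℝ) < 1 / (2 * j) * N := by linarith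
  have h8 : ((N / j : ℕ) : ℝ) * (2 * j) < N := by
    have := mul_lt_mul_of_pos_right h7 (by positivity : (0 : ℝ) < 2 * j)
    have e : 1 / (2 * (j : ℝ)) * N * (2 * j) = N := by field_simp
    linarith
  nlinarith

theorem familyThick_subset_familyInfinite : familyThick ⊆ familyInfinite := by
  intro A hA
  refine Set.infinite_of_not_bddAbove fun ⟨M, hM⟩ => ?_
  obtain ⟨i, hi⟩ := hA (M + 2) (by omega)
  have := hM (hi (M + 1) (by omega))
  omega

/-- The finitely many memberships counted at `y` persist nearby, so the count cannot drop. -/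
theorem isOpen_lt_ncard {Y : Type*} [TopologicalSpace Y] {A : Y → Set ℕ}
    (h : ∀ i, IsOpen {y | i ∈ A y}) (c : ℝ) (N : ℕ) :
    IsOpen {y | c < ((A y ∩ Set.Iio N).ncard : ℝ)} := by
  rw [isOpen_iff_mem_nhds]
  intro y hy
  have hfin : (A y ∩ Set.Iio N).Finite := (Set.finite_Iio N).subset Set.inter_subset_right
  have : ∀ᶠ z in 𝓝 y, ∀ i ∈ A y ∩ Set.Iio N, i ∈ A z :=
    (eventually_all_finite hfin).2 fun i hi => (h i).mem_nhds hi.1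
  filter_upwards [this] with z hz
  refine lt_of_lt_of_le hy ?_
  have hsub : A y ∩ Set.Iio N ⊆ A z ∩ Set.Iio N := fun i hi => ⟨hz i hi, hi.2⟩
  exact_mod_cast Set.ncard_le_ncard hsub ((Set.finite_Iio N).subset Set.inter_subset_right)

theorem isGδ_familyUd1 {Y : Type*} [TopologicalSpace Y] {A : Y → Set ℕ}
    (h : ∀ i, IsOpen {y | i ∈ A y}) : IsGδ {y | A y ∈ familyUd1} := by
  have : {y | A y ∈ familyUd1} = ⋂ (k : ℕ) (M : ℕ), ⋃ N ≥ M,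
      {y | (1 - 1 / (k + 1 : ℝ)) * N < ((A y ∩ Set.Iio N).ncard : ℝ)} := by
    ext y
    simp only [Set.mem_ofPred_eq, Set.mem_iInter, Set.mem_iUnion, mem_familyUd1_iff]
    constructor
    · intro hy k M
      obtain ⟨N, hN, h⟩ := frequently_atTop.1 (hy (1 - 1 / (k + 1 : ℝ)) (by
        have : (0 : ℝ) < 1 / (k + 1 : ℝ) := by positivity
        linarith)) M
      exact ⟨N, hN, h⟩
    · intro hy c hc
      obtain ⟨k, hk⟩ := exists_nat_one_div_lt (sub_pos.2 hc)
      refine frequently_atTop.2 fun M => ?_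
      obtain ⟨N, hN, h⟩ := hy k M
      refine ⟨N, hN, lt_of_le_of_lt ?_ h⟩
      exact mul_le_mul_of_nonneg_right (by linarith) (Nat.cast_nonneg N)
  rw [this]
  exact IsGδ.iInter fun k => IsGδ.iInter fun M =>
    (isOpen_biUnion fun N _ => isOpen_lt_ncard h _ N).isGδ

end Density

/-! ### Separation and proximity of tuples. -/

section Tuples

variable {X : Type*} [MetricSpace X] {f : X → X} {n : ℕ} {x : Fin n → X} {r : ℝ}

theorem minDist_le (x : Fin n → X) {j k : Fin n} (h : j ≠ k) : minDist x ≤ dist (x j) (x k) := by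
  have hb := (Set.finite_range fun p : {p : Fin n × Fin n // p.1 < p.2} =>
    dist (x p.1.1) (x p.1.2)).bddBelow
  rcases h.lt_or_gt with h | h
  · exact ciInf_le hb ⟨(j, k), h⟩
  · rw [dist_comm]
    exact ciInf_le hb ⟨(k, j), h⟩

theorem nonempty_pairs (hn : 2 ≤ n) : Nonempty {p : Fin n × Fin n // p.1 < p.2} :=
  ⟨⟨(⟨0, by omega⟩, ⟨1, by omega⟩), by simp⟩⟩

theorem le_minDist (hn : 2 ≤ n) (h : ∀ j k, j ≠ k → r ≤ dist (x j) (x k)) : r ≤ minDist x :=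
  have := nonempty_pairs hn
  le_ciInf fun p => h _ _ p.2.ne

theorem lt_minDist_iff (hn : 2 ≤ n) : r < minDist x ↔ ∀ j k, j ≠ k → r < dist (x j) (x k) := by
  refine ⟨fun h j k hjk => h.trans_le (minDist_le x hjk), fun h => ?_⟩
  have := nonempty_pairs hn
  obtain ⟨p, hp⟩ := exists_eq_ciInf_of_finite
    (f := fun p : {p : Fin n × Fin n // p.1 < p.2} => dist (x p.1.1) (x p.1.2))
  rw [minDist, ← hp]
  exact h _ _ p.2.ne

theorem maxDist_lt_iff (hn : 2 ≤ n) : maxDist x < r ↔ ∀ j k, j ≠ k → dist (x j) (x k) < r := by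
  have := nonempty_pairs hn
  have hb := (Set.finite_range fun p : {p : Fin n × Fin n // p.1 < p.2} =>
    dist (x p.1.1) (x p.1.2)).bddAbove
  constructor
  · intro h j k hjk
    refine lt_of_le_of_lt ?_ h
    rcases hjk.lt_or_gt with hjk | hjk
    · exact le_ciSup hb ⟨(j, k), hjk⟩
    · rw [dist_comm]
      exact le_ciSup hb ⟨(k, j), hjk⟩
  · intro h
    obtain ⟨p, hp⟩ := exists_eq_ciSup_of_finite
      (f := fun p : {p : Fin n × Fin n // p.1 < p.2} => dist (x p.1.1) (x p.1.2))
    rw [maxDist, ← hp]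
    exact h _ _ p.2.ne

theorem IsDistalTuple.lt_dist (h : IsDistalTuple f r x) (i : ℕ) {j k : Fin n} (hjk : j ≠ k) :
    r < dist (f^[i] (x j)) (f^[i] (x k)) := by
  refine lt_of_lt_of_le h ((ciInf_le ⟨0, ?_⟩ i).trans (minDist_le _ hjk))
  rintro _ ⟨i, rfl⟩
  exact Real.iInf_nonneg fun _ => dist_nonneg

/-- Limits preserve only weak inequalities; halving restores the strict bound on the infimum. -/
theorem isDistalTuple_half (hn : 2 ≤ n) (hr : 0 < r)
    (h : ∀ i j k, j ≠ k → r ≤ dist (f^[i] (x j)) (f^[i] (x k))) : IsDistalTuple f (r / 2) x :=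
  lt_of_lt_of_le (by linarith) (le_ciInf fun i => le_minDist hn (h i))

theorem isOpen_mem_sepSet (hf : Continuous f) (hn : 2 ≤ n) {Y : Type*} [TopologicalSpace Y]
    {g : Y → Fin n → X} (hg : Continuous g) (r : ℝ) (i : ℕ) :
    IsOpen {y | i ∈ sepSet f (g y) r} := by
  have : {y | i ∈ sepSet f (g y) r} =
      ⋂ (j : Fin n) (k : Fin n) (_ : j ≠ k), {y | r < dist (f^[i] (g y j)) (f^[i] (g y k))} := by
    ext y
    simp only [sepSet, Set.mem_ofPred_eq, lt_minDist_iff hn, Set.mem_iInter]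
  rw [this]
  have hfi := hf.iterate i
  exact isOpen_iInter_of_finite fun j => isOpen_iInter_of_finite fun k =>
    isOpen_iInter_of_finite fun _ => isOpen_lt continuous_const (by fun_prop)

theorem isOpen_mem_proxSet (hf : Continuous f) (hn : 2 ≤ n) {Y : Type*} [TopologicalSpace Y]
    {g : Y → Fin n → X} (hg : Continuous g) (r : ℝ) (i : ℕ) :
    IsOpen {y | i ∈ proxSet f (g y) r} := by
  have : {y | i ∈ proxSet f (g y) r} =
      ⋂ (j : Fin n) (k : Fin n) (_ : j ≠ k), {y | dist (f^[i] (g y j)) (f^[i] (g y k)) < r} := by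
    ext y
    simp only [proxSet, Set.mem_ofPred_eq, maxDist_lt_iff hn, Set.mem_iInter]
  rw [this]
  have hfi := hf.iterate i
  exact isOpen_iInter_of_finite fun j => isOpen_iInter_of_finite fun k =>
    isOpen_iInter_of_finite fun _ => isOpen_lt (by fun_prop) continuous_const

theorem proxSet_mono {r' : ℝ} (h : r ≤ r') : proxSet f x r ⊆ proxSet f x r' :=
  fun _ hi => lt_of_lt_of_le hi h

theorem isGδ_proxSet (hf : Continuous f) (hn : 2 ≤ n) {Y : Type*} [TopologicalSpace Y]
    {g : Y → Fin n → X} (hg : Continuous g) :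
    IsGδ (⋂ (ε : ℝ) (_ : 0 < ε), {y | proxSet f (g y) ε ∈ familyUd1}) := by
  have : (⋂ (ε : ℝ) (_ : 0 < ε), {y | proxSet f (g y) ε ∈ familyUd1}) =
      ⋂ k : ℕ, {y | proxSet f (g y) (1 / (k + 1 : ℝ)) ∈ familyUd1} := by
    ext y
    simp only [Set.mem_iInter]
    refine ⟨fun h k => h _ (by positivity), fun h ε hε => ?_⟩
    obtain ⟨k, hk⟩ := exists_nat_one_div_lt hε
    exact familyUd1_mono (h k) (proxSet_mono hk.le)
  rw [this]
  exact IsGδ.iInter fun k => isGδ_familyUd1 (isOpen_mem_proxSet hf hn hg _)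

end Tuples

/-! ### Distal tuples in proximal classes. -/

section Classes

variable {X : Type*} [MetricSpace X] {f : X → X} {C D : Set X} {n : ℕ} {δ : ℝ}

theorem mem_proximalClasses_iff (hC : ChainTransitiveOn f C) :
    D ∈ proximalClasses f C → ∃ d ∈ D, d ∈ C ∧ ∀ b, b ∈ D ↔ b ∈ C ∧ ChainProximal f C d b := by
  rintro ⟨a, ha, rfl⟩
  exact ⟨a, ⟨ha, fun δ hδ => hC.refl hδ ha⟩, ha, fun b => Iff.rfl⟩

theorem eventually_near_of_mem_basin (hC : ChainTransitiveOn f C) {x : X} (hx : x ∈ basin f C)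
    {η : ℝ} (hη : 0 < η) : ∀ᶠ i in atTop, ∃ q ∈ C, dist (f^[i] x) q < η :=
  (Tendsto.eventually_lt_const hη hx).mono fun _ hi =>
    (Metric.infDist_lt_iff hC.nonempty).1 hi

theorem eventually_near_of_mem_stableClass (hC : ChainTransitiveOn f C) {x d : X}
    (hx : x ∈ stableClass f C D) (hd : d ∈ D) (hδ : 0 < δ) {η : ℝ} (hη : 0 < η) :
    ∀ᶠ i in atTop, ∃ e, CyclicRel f C δ d e ∧ dist (f^[i] x) (f^[i] e) < η := by
  obtain ⟨_, ⟨a, ha, rfl⟩, hDE, hlim⟩ := hx.2 δ hδ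
  refine (hlim.eventually_lt_const hη).mono fun i hi => ?_
  obtain ⟨_, ⟨e, he, rfl⟩, hlt⟩ :=
    (Metric.infDist_lt_iff (Set.Nonempty.image _ ⟨d, hDE hd⟩)).1 hi
  exact ⟨e, (hC.symm hδ (hDE hd).2).trans he.2, hlt⟩

theorem mem_stableClass_of_tendsto (hC : ChainTransitiveOn f C) {x d : X}
    (hD : D ∈ proximalClasses f C) (hd : d ∈ D) (hx : x ∈ basin f C)
    (h : ∀ δ > 0, Tendsto (fun i : ℕ => Metric.infDist (f^[i] x)
      (f^[i] '' {b ∈ C | CyclicRel f C δ d b})) atTop (𝓝 0)) : x ∈ stableClass f C D := by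
  obtain ⟨a, ha, haC, hDa⟩ := mem_proximalClasses_iff hC hD
  have hda := (hDa d).1 hd
  refine ⟨hx, fun δ hδ => ⟨_, ⟨d, hda.1, rfl⟩, fun b hb => ?_, h δ hδ⟩⟩
  have hba := (hDa b).1 hb
  exact ⟨hba.1, (hC.symm hδ (hda.2 δ hδ)).trans (hba.2 δ hδ)⟩

theorem subset_stableClass (hC : ChainTransitiveOn f C) (hD : D ∈ proximalClasses f C) :
    D ⊆ stableClass f C D := by
  intro d hd
  obtain ⟨a, ha, haC, hDa⟩ := mem_proximalClasses_iff hC hD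
  have hdC := ((hDa d).1 hd).1
  refine mem_stableClass_of_tendsto hC hD hd ?_ fun δ hδ => ?_
  · refine tendsto_const_nhds.congr fun i => ?_
    exact (Metric.infDist_zero_of_mem (hC.mapsTo.iterate i hdC)).symm
  · refine tendsto_const_nhds.congr fun i => ?_
    have hdd : d ∈ {b ∈ C | CyclicRel f C δ d b} := ⟨hdC, hC.refl hδ hdC⟩
    exact (Metric.infDist_zero_of_mem (Set.mem_image_of_mem _ hdd)).symm

/-- Late orbit segments in the basin project to `δ`-chains of `f|_C`. These have a common length, so
equivalence at one late time propagates to all later times. -/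
theorem ChainTransitiveOn.rel_of_near_tail [CompactSpace X] (hf : Continuous f)
    (hC : ChainTransitiveOn f C) {y : Fin n → X} (hy : ∀ l, y l ∈ basin f C)
    (hrel : ∀ δ > 0, ∀ η > 0, ∃ᶠ i in atTop, ∃ p : Fin n → X,
      (∀ l, dist (f^[i] (y l)) (p l) < η) ∧ ∀ l l', CyclicRel f C δ (p l) (p l')) (hδ : 0 < δ) :
    ∃ η > 0, ∃ I, ∀ i ≥ I, ∀ p : Fin n → X, (∀ l, p l ∈ C) →
      (∀ l, dist (f^[i] (y l)) (p l) < η) → ∀ l l', CyclicRel f C δ (p l) (p l') := by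
  obtain ⟨η₁, hη₁, hclose⟩ := hC.exists_rel_of_dist_lt hf hδ
  obtain ⟨η₂, hη₂, hη₂δ, hmod⟩ := exists_uniform_modulus hf (δ := δ / 2) (by positivity)
  set η := min (η₁ / 2) η₂ with hηdef
  have hη : 0 < η := by positivity
  have hηη₁ : η ≤ η₁ / 2 := min_le_left _ _
  have hηη₂ : η ≤ η₂ := min_le_right _ _
  have hev : ∀ᶠ i in atTop, ∀ l, ∃ q ∈ C, dist (f^[i] (y l)) q < η :=
    eventually_all.2 fun l => eventually_near_of_mem_basin hC (hy l) hη
  obtain ⟨I₀, hI₀⟩ := eventually_atTop.1 hev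
  have : Nonempty X := ⟨hC.nonempty.some⟩
  choose! q hqC hq using hI₀
  have hnear : ∀ {i l} {p p' : X}, p ∈ C → p' ∈ C → dist (f^[i] (y l)) p < η →
      dist (f^[i] (y l)) p' < η → CyclicRel f C δ p p' := fun {i l p p'} hp hp' h h' => by
    refine hclose _ hp _ hp' ?_
    have := dist_triangle_left p p' (f^[i] (y l))
    linarith
  obtain ⟨i₀, hi₀, p₀, hp₀, hp₀rel⟩ := frequently_atTop.1 (hrel δ hδ η hη) I₀
  -- Starting at `i₀ + 1` gives the projected chains positive length.
  refine ⟨η, hη, i₀ + 1, fun i hi p hpC hp l l' => ?_⟩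
  have hchain : ∀ l, ChainOfLength f C δ (i - i₀) (q i₀ l) (q i l) := fun l => by
    refine ⟨fun j => q (i₀ + j) l, ⟨by omega, fun j _ => hqC _ (by omega) l, fun j _ => ?_⟩, rfl,
      by simp only []; congr 1; omega⟩
    have h1 : dist (f (q (i₀ + j) l)) (f (f^[i₀ + j] (y l))) < δ / 2 :=
      hmod _ _ (by rw [dist_comm]; exact (hq _ (by omega) l).trans_le hηη₂)
    have h2 : dist (f^[i₀ + j + 1] (y l)) (q (i₀ + j + 1) l) < η := hq _ (by omega) l
    rw [Function.iterate_succ_apply'] at h2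
    have := dist_triangle (f (q (i₀ + j) l)) (f (f^[i₀ + j] (y l))) (q (i₀ + (j + 1)) l)
    rw [← add_assoc] at this
    simp only [← add_assoc]
    linarith
  have hpC₀ : ∀ l, p₀ l ∈ C := fun l => by
    obtain ⟨_, -, h⟩ := hp₀rel l l
    exact h.left_mem
  have hstart : CyclicRel f C δ (q i₀ l) (q i₀ l') :=
    (hnear (hqC _ hi₀ l) (hpC₀ l) (hq _ hi₀ l) (hp₀ l)).trans
      ((hp₀rel l l').trans (hnear (hpC₀ l') (hqC _ hi₀ l') (hp₀ l') (hq _ hi₀ l')))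
  have hend := hC.rel_of_chains hδ hstart (hchain l) (hchain l')
  exact (hnear (hpC l) (hqC i (by omega) l) (hp l) (hq i (by omega) l)).trans
    (hend.trans (hnear (hqC i (by omega) l') (hpC l') (hq i (by omega) l') (hp l')))

/-- A tuple in the basin, separated on arbitrarily long blocks and whose orbits are infinitely often
near equivalent points, gives rise to a distal tuple in a proximal class. -/
theorem exists_distal_of_thick [CompactSpace X] (hf : Continuous f)
    (hC : ChainTransitiveOn f C) (hn : 2 ≤ n) {y : Fin n → X} (hy : ∀ l, y l ∈ basin f C)
    (hδ : 0 < δ) (hS : sepSet f y δ ∈ familyThick)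
    (hrel : ∀ δ > 0, ∀ η > 0, ∃ᶠ i in atTop, ∃ p : Fin n → X,
      (∀ l, dist (f^[i] (y l)) (p l) < η) ∧ ∀ l l', CyclicRel f C δ (p l) (p l')) :
    ∃ D ∈ proximalClasses f C, ∃ δ : ℝ, 0 < δ ∧
      ∃ x : Fin n → X, (∀ l, x l ∈ D) ∧ IsDistalTuple f δ x := by
  -- The midpoint `s k + k` tends to infinity even if `s k` does not, so the limit lies in `C`, and
  -- `k` further iterates stay in the block, so the limit is separated forever.
  choose s hs using fun k : ℕ => hS (2 * k + 1) (by omega)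
  obtain ⟨z, φ, hφ, hz⟩ := CompactSpace.tendsto_subseq fun k : ℕ => fun l => f^[s k + k] (y l)
  rw [tendsto_pi_nhds] at hz
  simp only [Function.comp_apply] at hz
  have hsφ : Tendsto (fun k => s (φ k) + φ k) atTop atTop :=
    tendsto_atTop_mono (fun k => Nat.le_add_left _ _) hφ.tendsto_atTop
  have hzC : ∀ l, z l ∈ C := fun l => by
    rw [hC.isClosed.mem_iff_infDist_zero hC.nonempty]
    have h : Tendsto (fun i : ℕ => Metric.infDist (f^[i] (y l)) C) atTop (𝓝 0) := hy l
    exact tendsto_nhds_unique (((Metric.continuous_infDist_pt C).tendsto _).comp (hz l))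
      (h.comp hsφ)
  have hzrel : ∀ l l', ChainProximal f C (z l) (z l') := fun l l' δ' hδ' => by
    obtain ⟨η, hη, I, hI⟩ := hC.rel_of_near_tail hf hy hrel hδ'
    have h1 : ∀ᶠ k in atTop, ∀ l, dist (f^[s (φ k) + φ k] (y l)) (z l) < η :=
      eventually_all.2 fun l => (hz l).eventually (Metric.ball_mem_nhds _ hη)
    obtain ⟨k, hk, hkI⟩ := (h1.and (hsφ.eventually_ge_atTop I)).exists
    exact hI _ hkI z hzC hk l l'
  have hzd : ∀ i j k, j ≠ k → δ ≤ dist (f^[i] (z j)) (f^[i] (z k)) := fun i j k hjk => by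
    have hlim := ((((hf.iterate i).tendsto _).comp (hz j)).dist
      (((hf.iterate i).tendsto _).comp (hz k)))
    refine ge_of_tendsto hlim ((hφ.tendsto_atTop.eventually_ge_atTop i).mono fun m hm => ?_)
    have := (lt_minDist_iff hn).1 (hs (φ m) (φ m + i) (by omega)) j k hjk
    simp only [Function.comp_apply, ← Function.iterate_add_apply]
    rw [show i + (s (φ m) + φ m) = s (φ m) + (φ m + i) by ring]
    exact this.le
  exact ⟨_, ⟨z ⟨0, by omega⟩, hzC _, rfl⟩, δ / 2, by positivity, z, fun l => ⟨hzC l, hzrel _ l⟩,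
    isDistalTuple_half hn hδ hzd⟩

/-- At a late time of proximity, the points of `C` nearby are close to each other, hence equivalent.
-/
theorem exists_distal_of_basin [CompactSpace X] (hf : Continuous f)
    (hC : ChainTransitiveOn f C) (hn : 2 ≤ n) {y : Fin n → X} (hy : ∀ l, y l ∈ basin f C)
    (hδ : 0 < δ) (hS : sepSet f y δ ∈ familyThick)
    (hT : ∀ ε > 0, proxSet f y ε ∈ familyInfinite) :
    ∃ D ∈ proximalClasses f C, ∃ δ : ℝ, 0 < δ ∧
      ∃ x : Fin n → X, (∀ l, x l ∈ D) ∧ IsDistalTuple f δ x := by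
  refine exists_distal_of_thick hf hC hn hy hδ hS fun δ' hδ' η hη => ?_
  obtain ⟨η₁, hη₁, hclose⟩ := hC.exists_rel_of_dist_lt hf hδ'
  have hη' : 0 < min η (η₁ / 3) := by positivity
  have hev : ∀ᶠ i in atTop, ∀ l, ∃ q ∈ C, dist (f^[i] (y l)) q < min η (η₁ / 3) :=
    eventually_all.2 fun l => eventually_near_of_mem_basin hC (hy l) hη'
  have hfreq := Nat.frequently_atTop_iff_infinite.2 (hT (η₁ / 3) (by positivity))
  refine (hfreq.and_eventually hev).mono fun i ⟨hi, hi'⟩ => ?_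
  choose q hqC hq using hi'
  refine ⟨q, fun l => (hq l).trans_le (min_le_left _ _),
    fun l l' => hclose _ (hqC l) _ (hqC l') ?_⟩
  have h1 := (hq l).trans_le (min_le_right _ _)
  have h2 := (hq l').trans_le (min_le_right _ _)
  have h3 : dist (f^[i] (y l)) (f^[i] (y l')) < η₁ / 3 := by
    by_cases h : l = l'
    · subst h
      rw [dist_self]
      positivity
    · exact (maxDist_lt_iff hn).1 hi l l' h
  have h4 := dist_triangle4 (q l) (f^[i] (y l)) (f^[i] (y l')) (q l')
  rw [dist_comm (q l) (f^[i] (y l))] at h4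
  linarith

/-- Here equivalence is available at every late time: the orbits are near iterates of points of one
class `D_δ`. -/
theorem exists_distal_of_stableClass [CompactSpace X] (hf : Continuous f)
    (hC : ChainTransitiveOn f C) (hn : 2 ≤ n) (hD : D ∈ proximalClasses f C) {y : Fin n → X}
    (hy : ∀ l, y l ∈ stableClass f C D) (hδ : 0 < δ) (hS : sepSet f y δ ∈ familyThick) :
    ∃ D ∈ proximalClasses f C, ∃ δ : ℝ, 0 < δ ∧
      ∃ x : Fin n → X, (∀ l, x l ∈ D) ∧ IsDistalTuple f δ x := by
  obtain ⟨d, hd, -, -⟩ := mem_proximalClasses_iff hC hD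
  refine exists_distal_of_thick hf hC hn (fun l => (hy l).1) hδ hS fun δ' hδ' η hη => ?_
  refine Eventually.frequently ((eventually_all.2 fun l =>
    eventually_near_of_mem_stableClass hC (hy l) hd hδ' hη).mono fun i hi => ?_)
  choose e he hdist using hi
  exact ⟨fun l => f^[i] (e l), hdist, fun l l' =>
    hC.rel_iterate hδ' ((hC.symm hδ' (he l)).trans (he l')) i⟩

/-- Distal tuples can be moved from one proximal class to any other. -/
theorem exists_distal_in_proximalClass [CompactSpace X] (hf : Continuous f)
    (hC : ChainTransitiveOn f C) (hn : 2 ≤ n) {D' : Set X} (hD : D ∈ proximalClasses f C)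
    (hD' : D' ∈ proximalClasses f C) (hδ : 0 < δ) {x : Fin n → X} (hx : ∀ l, x l ∈ D)
    (hdist : IsDistalTuple f δ x) :
    ∃ z : Fin n → X, (∀ l, z l ∈ D') ∧ IsDistalTuple f (δ / 2) z := by
  obtain ⟨a, -, haC, hDa⟩ := mem_proximalClasses_iff hC hD
  obtain ⟨b, -, hbC, hDb⟩ := mem_proximalClasses_iff hC hD'
  have hxC := fun l => ((hDa _).1 (hx l)).1
  have hxrel := fun l => ((hDa _).1 (hx l)).2
  -- Comparing the chain from `a` to `b` with an orbit segment of the same length shows that `f^[s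
  -- k]` sends points equivalent to `a` to points equivalent to `b`, up to a precision that vanishes
  -- in the limit.
  choose s hs using fun k : ℕ => hC.exists_chain (1 / (k + 1 : ℝ)) (by positivity) a haC b hbC
  obtain ⟨z, φ, hφ, hz⟩ := CompactSpace.tendsto_subseq fun k : ℕ => fun l => f^[s k] (x l)
  rw [tendsto_pi_nhds] at hz
  simp only [Function.comp_apply] at hz
  have hzC : ∀ l, z l ∈ C := fun l => hC.isClosed.mem_of_tendsto (hz l)
    (Eventually.of_forall fun k => hC.mapsTo.iterate _ (hxC l))
  refine ⟨z, fun l => (hDb _).2 ⟨hzC l, fun δ' hδ' => ?_⟩,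
    isDistalTuple_half hn hδ fun i j k hjk => ?_⟩
  · obtain ⟨η, hη, hclose⟩ := hC.exists_rel_of_dist_lt hf hδ'
    have h1 : ∀ᶠ k in atTop, dist (f^[s (φ k)] (x l)) (z l) < η :=
      (hz l).eventually (Metric.ball_mem_nhds _ hη)
    have h2 : ∀ᶠ m : ℕ in atTop, 1 / (((φ m : ℕ) : ℝ) + 1) < δ' :=
      (tendsto_one_div_add_atTop_nhds_zero_nat.comp hφ.tendsto_atTop).eventually_lt_const hδ'
    obtain ⟨k, hk1, hk2⟩ := (h1.and h2).exists
    have hchain := (hs (φ k)).mono hk2.le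
    exact (hC.rel_of_chains hδ' (hxrel l δ' hδ') hchain
      (chainOfLength_iterate hδ'.le hC.mapsTo (hxC l) hchain.pos)).trans
      (hclose _ (hC.mapsTo.iterate _ (hxC l)) _ (hzC l) hk1)
  · have hlim := ((((hf.iterate i).tendsto _).comp (hz j)).dist
      (((hf.iterate i).tendsto _).comp (hz k)))
    refine ge_of_tendsto hlim (Eventually.of_forall fun m => ?_)
    simp only [Function.comp_apply, ← Function.iterate_add_apply]
    exact (hdist.lt_dist _ hjk).le

end Classes

/-! ### Gluing sequences along a partition of time. -/

section Concatenation

variable {X : Type*} {t : ℕ → ℕ}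

/-- Both end points of a block are covered by its formula, so each single step can be checked inside
one block. -/
theorem exists_concat (ht : StrictMono t) (a : ℕ → X) (c : ℕ → ℕ → X) (ha : a (t 0) = c 0 0)
    (hc : ∀ j, c j (t (j + 1) - t j) = c (j + 1) 0) :
    ∃ x : ℕ → X, (∀ i ≤ t 0, x i = a i) ∧ ∀ j, ∀ i ≤ t (j + 1) - t j, x (t j + i) = c j i := by
  have hex : ∀ m, ∃ j, m < t (j + 1) := fun m =>
    ⟨m, (Nat.lt_succ_self m).trans_le (ht.id_le (m + 1))⟩
  have key : ∀ j i, i < t (j + 1) - t j →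
      (if t j + i < t 0 then a (t j + i) else
        c (Nat.find (hex (t j + i))) (t j + i - t (Nat.find (hex (t j + i))))) = c j i := by
    intro j i hi
    have h0 : t 0 ≤ t j := ht.monotone (Nat.zero_le j)
    have hfind : Nat.find (hex (t j + i)) = j := by
      rw [Nat.find_eq_iff]
      refine ⟨by omega, fun j' hj' => ?_⟩
      have : t (j' + 1) ≤ t j := ht.monotone hj'
      omega
    rw [if_neg (by omega), hfind, Nat.add_sub_cancel_left]
  refine ⟨fun m => if m < t 0 then a m else c (Nat.find (hex m)) (m - t (Nat.find (hex m))),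
    fun i hi => ?_, fun j i hi => ?_⟩
  · rcases hi.lt_or_eq with hi | rfl
    · simp [hi]
    · have := key 0 0 (Nat.sub_pos_of_lt (ht (Nat.lt_succ_self 0)))
      simpa only [add_zero, ha] using this
  · rcases hi.lt_or_eq with hi | rfl
    · exact key j i hi
    · have hj := ht (Nat.lt_succ_self j)
      have hj' := ht (Nat.lt_succ_self (j + 1))
      simp only [Nat.succ_eq_add_one] at hj hj'
      have := key (j + 1) 0 (by omega)
      rw [hc, ← this, add_zero, Nat.add_sub_cancel' hj.le]

/-- Blocks are open on the left: `s > 0` is what a chain ending at time `i` needs. -/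
theorem exists_block (ht : StrictMono t) {J i : ℕ} (hi : t J < i) :
    ∃ j ≥ J, ∃ s, 0 < s ∧ s ≤ t (j + 1) - t j ∧ i = t j + s := by
  classical
  have hex : ∃ j, i ≤ t (j + 1) := ⟨i, (Nat.le_succ i).trans (ht.id_le (i + 1))⟩
  have hspec := Nat.find_spec hex
  have hlow : t (Nat.find hex) < i := by
    rcases h : Nat.find hex with _ | j
    · exact (ht.monotone (Nat.zero_le J)).trans_lt hi
    · exact not_le.1 (Nat.find_min hex (h ▸ Nat.lt_succ_self j))
  refine ⟨Nat.find hex, ?_, i - t (Nat.find hex), by omega, by omega, by omega⟩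
  by_contra! hlt
  have : t (Nat.find hex + 1) ≤ t J := ht.monotone hlt
  omega

end Concatenation

/-! ### Steering pseudo orbits and shadowing them. -/

section Construction

variable {X : Type*} [MetricSpace X] {f : X → X} {C D : Set X} {n : ℕ} {δ : ℝ}

/-- Finitely many pairs of equivalent points are joined by chains of a common length, which first
follow the orbits for a prescribed time. -/
theorem ChainTransitiveOn.exists_common_chain (hC : ChainTransitiveOn f C) (hδ : 0 < δ)
    {e u : Fin n → X} (heu : ∀ l, CyclicRel f C δ (e l) (u l)) {T L m : ℕ} (hL : 0 < L)
    (hT : cyclePeriod f C δ ∣ T) (hm : cyclePeriod f C δ ∣ m) (hm0 : 0 < m) :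
    ∃ k, m ∣ T + (L + k) ∧ ∀ l, ChainOfLength f C δ k (f^[L] (e l)) (u l) := by
  have heC : ∀ l, e l ∈ C := fun l => by
    obtain ⟨_, -, h⟩ := heu l
    exact h.left_mem
  have huC : ∀ l, u l ∈ C := fun l => by
    obtain ⟨_, -, h⟩ := heu l
    exact h.right_mem
  have key : ∀ l, ∃ K, ∀ k ≥ K, cyclePeriod f C δ ∣ L + k →
      ChainOfLength f C δ k (f^[L] (e l)) (u l) := fun l => by
    obtain ⟨k₀, hk₀⟩ := hC.exists_chain δ hδ _ (hC.mapsTo.iterate L (heC l)) _ (huC l)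
    obtain ⟨K, hK⟩ := hC.exists_chain_of_modEq hδ hk₀
    refine ⟨K, fun k hk hdvd => hK k hk ?_⟩
    -- Chains from `e l` to `u l` have length divisible by the period, so the remainder after `L`
    -- orbit steps has a residue that does not depend on `l`.
    obtain ⟨q, hq, hchain⟩ := heu l
    have h1 := hC.modEq_of_chains hδ hchain
      ((chainOfLength_iterate hδ.le hC.mapsTo (heC l) hL).trans hk₀)
    have h2 := (Nat.modEq_zero_iff_dvd.2 hdvd).trans ((Nat.modEq_zero_iff_dvd.2 hq).symm.trans h1)
    exact Nat.ModEq.add_left_cancel' L h2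
  choose K hK using key
  have hKle : ∀ l, K l ≤ ∑ l, K l := fun l =>
    Finset.single_le_sum (fun _ _ => Nat.zero_le _) (Finset.mem_univ l)
  -- The final time is chosen as `m * S`: divisible by `m`, and late enough for every threshold `K
  -- l`.
  set S := T + L + ∑ l, K l with hS
  have hSm : S ≤ m * S := Nat.le_mul_of_pos_left S hm0
  have hsum : T + (L + (m * S - (T + L))) = m * S := by omega
  refine ⟨m * S - (T + L), ⟨S, hsum⟩, fun l => hK l _ (by have := hKle l; omega) ?_⟩
  refine (Nat.dvd_add_right hT).1 ?_
  rw [hsum]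
  exact hm.mul_right S

/-- One stage of the inductive construction: `T` is the time already elapsed, and `m` will be the
period for the next, finer precision. -/
theorem ChainTransitiveOn.exists_stage (hC : ChainTransitiveOn f C) (hδ : 0 < δ)
    {e u : Fin n → X} (heu : ∀ l, CyclicRel f C δ (e l) (u l)) {T L m : ℕ} (hL : 0 < L)
    (hT : cyclePeriod f C δ ∣ T) (hm : cyclePeriod f C δ ∣ m) (hm0 : 0 < m) :
    ∃ k, L ≤ k ∧ m ∣ T + k ∧ ∃ c : Fin n → ℕ → X, ∀ l, IsChainIn f C δ k (c l) ∧
      c l k = u l ∧ ∀ i ≤ L, c l i = f^[i] (e l) := by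
  obtain ⟨k, hk, hchain⟩ := hC.exists_common_chain hδ heu hL hT hm hm0
  have heC : ∀ l, e l ∈ C := fun l => by
    obtain ⟨_, -, h⟩ := heu l
    exact h.left_mem
  have : ∀ l, ∃ c, IsChainIn f C δ (L + k) c ∧ c (L + k) = u l ∧
      ∀ i ≤ L, c i = f^[i] (e l) := fun l => by
    obtain ⟨y, hy, hy0, hyk⟩ := hchain l
    have horb : IsChainIn f C δ L fun i => f^[i] (e l) := by
      refine ⟨hL, fun i _ => hC.mapsTo.iterate i (heC l), fun i _ => ?_⟩
      simp only [Function.iterate_succ_apply', dist_self]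
      exact hδ.le
    obtain ⟨z, hz, hz1, hz2⟩ := horb.append hy hy0.symm
    exact ⟨z, hz, by rw [hz2 k le_rfl, hyk], hz1⟩
  choose c hc using this
  exact ⟨L + k, Nat.le_add_right _ _, hk, c, hc⟩

/-- Chains that lead from points of `V^s(D)` to given points of `D` in a common time, of prescribed
residue. -/
theorem exists_initial_chains (hC : ChainTransitiveOn f C)
    (hD : D ∈ proximalClasses f C) {v u : Fin n → X} (hv : ∀ l, v l ∈ stableClass f C D)
    (hu : ∀ l, u l ∈ D) (hδ : 0 < δ) {m : ℕ} (hm : cyclePeriod f C δ ∣ m) (hm0 : 0 < m) :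
    ∃ k, m ∣ k ∧ ∃ c : Fin n → ℕ → X, ∀ l, IsChainIn f Set.univ δ k (c l) ∧
      c l 0 = v l ∧ c l k = u l := by
  obtain ⟨d, hd, hdC, hDd⟩ := mem_proximalClasses_iff hC hD
  obtain ⟨N, hN, hN1⟩ := ((eventually_all.2 fun l =>
    eventually_near_of_mem_stableClass hC (hv l) hd hδ hδ).and (eventually_gt_atTop 0)).exists
  choose e he hdist using hN
  obtain ⟨k, hk, hchain⟩ := hC.exists_common_chain hδ (e := e) (u := u)
    (fun l => (hC.symm hδ (he l)).trans (((hDd _).1 (hu l)).2 δ hδ)) hN1 (dvd_zero _) hm hm0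
  have : ∀ l, ∃ c, IsChainIn f Set.univ δ (N + k) c ∧ c 0 = v l ∧ c (N + k) = u l := fun l => by
    obtain ⟨y, hy, hy0, hyk⟩ := hchain l
    -- The only jump occurs in the last step, from the orbit of `v l` to that of a nearby point `e l
    -- ∈ D_δ`.
    have horb : IsChainIn f Set.univ δ N fun i => if i < N then f^[i] (v l) else f^[N] (e l) := by
      refine ⟨hN1, fun i _ => Set.mem_univ _, fun i hi => ?_⟩
      by_cases hi' : i + 1 < N
      · simp only [hi, hi', if_true, Function.iterate_succ_apply', dist_self]
        exact hδ.le
      · obtain rfl : i + 1 = N := by omega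
        simp only [hi, lt_irrefl, if_true, if_false, ← Function.iterate_succ_apply' f i (v l)]
        exact (hdist l).le
    obtain ⟨z, hz, hz1, hz2⟩ := horb.append
      ⟨hy.1, fun i _ => Set.mem_univ _, hy.2.2⟩ (by simp [hy0])
    exact ⟨z, hz, by simp [hz1 0 (Nat.zero_le _), hN1], by rw [hz2 k le_rfl, hyk]⟩
  choose c hc using this
  exact ⟨N + k, by simpa using hk, c, hc⟩

/-- Limit pseudo orbits that start in `V^s(D)` and, from time `t j` on, follow the orbits of
`u j l ∈ D` for a very long time. -/
theorem exists_limitPseudoOrbits [CompactSpace X] (hf : Continuous f) (hC : ChainTransitiveOn f C)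
    (hD : D ∈ proximalClasses f C) {d : X} (hd : d ∈ D) {v : Fin n → X}
    (hv : ∀ l, v l ∈ stableClass f C D) {u : ℕ → Fin n → X} (hu : ∀ j l, u j l ∈ D) (hδ : 0 < δ) :
    ∃ t L : ℕ → ℕ, ∃ x : Fin n → ℕ → X, StrictMono t ∧ (∀ j, j * t j ≤ L j) ∧ ∀ l,
      x l 0 = v l ∧ IsLimitPseudoOrbit f δ (x l) ∧
      (∀ j, ∀ i < L j, x l (t j + i) = f^[i] (u j l)) ∧
      ∀ δ' > 0, ∀ᶠ i in atTop, x l i ∈ f^[i] '' {b ∈ C | CyclicRel f C δ' d b} := by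
  have : Nonempty X := ⟨d⟩
  obtain ⟨a, ha, haC, hDa⟩ := mem_proximalClasses_iff hC hD
  have hrel : ∀ b ∈ D, ∀ b' ∈ D, ∀ δ' > 0, CyclicRel f C δ' b b' := fun b hb b' hb' δ' hδ' =>
    (hC.symm hδ' (((hDa b).1 hb).2 δ' hδ')).trans (((hDa b').1 hb').2 δ' hδ')
  have hdC : d ∈ C := ((hDa d).1 hd).1
  set η : ℕ → ℝ := fun j => δ / (j + 1) with hη
  have hηpos : ∀ j, 0 < η j := fun j => by positivity
  have hηanti : Antitone η := fun i j hij => by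
    simp only [hη]
    gcongr
  have hη0 : Tendsto η atTop (𝓝 0) := by
    have := (tendsto_one_div_add_atTop_nhds_zero_nat (𝕜 := ℝ)).const_mul δ
    simpa [hη, div_eq_mul_inv] using this
  have hηδ : ∀ j, η j ≤ δ := fun j => by
    have := hηanti (Nat.zero_le j)
    simpa [hη] using this
  obtain ⟨T₀, hT₀, a₀, ha₀⟩ := exists_initial_chains hC hD hv (hu 0) (hηpos 0) dvd_rfl
    (hC.cyclePeriod_pos (hηpos 0))
  -- Following orbits for `j * T + 1` steps dwarfs the elapsed time `T`; the divisibility at the end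
  -- is the hypothesis of the next stage.
  have hstage : ∀ j T, cyclePeriod f C (η j) ∣ T → ∃ k, ∃ c : Fin n → ℕ → X, j * T + 1 ≤ k ∧
      cyclePeriod f C (η (j + 1)) ∣ T + k ∧ ∀ l, IsChainIn f C (η j) k (c l) ∧
      c l k = u (j + 1) l ∧ ∀ i ≤ j * T + 1, c l i = f^[i] (u j l) := fun j T hT => by
    obtain ⟨k, h1, h2, c, h3⟩ := hC.exists_stage (hηpos j) (e := u j) (u := u (j + 1))
      (fun l => hrel _ (hu j l) _ (hu (j + 1) l) _ (hηpos j)) (Nat.succ_pos (j * T)) hT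
      (ChainTransitiveOn.cyclePeriod_dvd (hηanti (Nat.le_succ j)))
      (hC.cyclePeriod_pos (hηpos (j + 1)))
    exact ⟨k, c, h1, h2, h3⟩
  choose! k c hkL hkm hc using hstage
  set t : ℕ → ℕ := fun j => Nat.rec T₀ (fun j T => T + k j T) j with ht
  have ht0 : t 0 = T₀ := rfl
  have hts : ∀ j, t (j + 1) = t j + k j (t j) := fun j => rfl
  have htm : ∀ j, cyclePeriod f C (η j) ∣ t j := fun j => by
    induction j with
    | zero => exact hT₀
    | succ j ih => exact hkm j (t j) ih
  have htmono : StrictMono t := strictMono_nat_of_lt_succ fun j => by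
    have := hkL j (t j) (htm j)
    rw [hts]
    omega
  have htk : ∀ j, t (j + 1) - t j = k j (t j) := fun j => by rw [hts, Nat.add_sub_cancel_left]
  have hx := fun l => exists_concat htmono (a₀ l) (fun j => c j (t j) l)
    (by rw [ht0, (ha₀ l).2.2, (hc 0 T₀ hT₀ l).2.2 0 (Nat.zero_le _)]; rfl) (fun j => by
      rw [htk, (hc j _ (htm j) l).2.1, (hc (j + 1) _ (htm (j + 1)) l).2.2 0 (Nat.zero_le _)]; rfl)
  choose x hx₀ hx using hx
  simp only [htk] at hx
  have hstep : ∀ l J i, t J ≤ i → dist (f (x l i)) (x l (i + 1)) ≤ η J := fun l J i hi => by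
    obtain ⟨j, hj, s, hs, hs', his⟩ := exists_block htmono (Nat.lt_succ_of_le hi)
    obtain ⟨s, rfl⟩ : ∃ s', s = s' + 1 := ⟨s - 1, by omega⟩
    rw [htk] at hs'
    obtain rfl : i = t j + s := by omega
    rw [add_assoc, hx l j s (by omega), hx l j (s + 1) hs']
    exact ((hc j _ (htm j) l).1.2.2 s (by omega)).trans (hηanti hj)
  refine ⟨t, fun j => j * t j + 1, x, htmono, fun j => Nat.le_succ _, fun l =>
    ⟨by rw [hx₀ l 0 (Nat.zero_le _), (ha₀ l).2.1], ⟨fun i => ?_, ?_⟩, fun j i hi => ?_,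
    fun δ' hδ' => ?_⟩⟩
  · by_cases hi : t 0 ≤ i
    · exact (hstep l 0 i hi).trans (hηδ 0)
    · rw [hx₀ l i (by omega), hx₀ l (i + 1) (by omega)]
      exact ((ha₀ l).1.2.2 i (by omega)).trans (hηδ 0)
  · rw [Metric.tendsto_atTop]
    intro ε hε
    obtain ⟨J, hJ⟩ := (hη0.eventually_lt_const hε).exists
    refine ⟨t J, fun i hi => ?_⟩
    rw [Real.dist_0_eq_abs, abs_of_nonneg dist_nonneg]
    exact (hstep l J i hi).trans_lt hJ
  · have h1 := hkL j _ (htm j)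
    dsimp only at hi
    rw [hx l j i (by omega), (hc j _ (htm j) l).2.2 i hi.le]
  · obtain ⟨J, hJ⟩ := (hη0.eventually_lt_const hδ').exists
    filter_upwards [eventually_gt_atTop (t J)] with i hi
    obtain ⟨j, hj, s, hs, hs', rfl⟩ := exists_block htmono hi
    rw [htk] at hs'
    rw [hx l j s hs']
    have hchain := ((hc j _ (htm j) l).1.prefix_chain hs hs').mono ((hηanti hj).trans hJ.le)
    rw [(hc j _ (htm j) l).2.2 0 (Nat.zero_le _)] at hchain
    obtain ⟨b, hbC, hb⟩ := hC.iterate_surjOn hf (t j + s) hchain.right_mem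
    refine ⟨b, ⟨hbC, ?_⟩, hb⟩
    -- Two chains from `d` to the current point, via `b` and via `u j l`, have lengths `q + (t j +
    -- s)` and `r + s`. As the period divides `r` and `t j`, it divides `q`.
    obtain ⟨q, hq⟩ := hC.exists_chain δ' hδ' d hdC b hbC
    obtain ⟨r, hr, hr'⟩ := hrel d hd _ (hu j l) δ' hδ'
    have hborb := chainOfLength_iterate hδ'.le hC.mapsTo hbC (by omega : 0 < t j + s)
    rw [hb] at hborb
    have hmod := hC.modEq_of_chains hδ' (hr'.trans hchain) (hq.trans hborb)
    rw [← add_assoc] at hmod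
    have htj : cyclePeriod f C δ' ∣ t j :=
      (ChainTransitiveOn.cyclePeriod_dvd ((hηanti hj).trans hJ.le)).trans (htm j)
    have h2 := (Nat.modEq_zero_iff_dvd.2 hr).symm.trans (Nat.ModEq.add_right_cancel' s hmod)
    exact ⟨q, (Nat.dvd_add_left htj).1 (Nat.modEq_zero_iff_dvd.1 h2.symm), hq⟩

theorem exists_chaotic_tuple [CompactSpace X] (hf : Continuous f) (hs : SLimitShadowing f)
    (hC : ChainTransitiveOn f C) (hn : 2 ≤ n) (hD : D ∈ proximalClasses f C) {r : ℝ} (hr : 0 < r)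
    {z : Fin n → X} (hz : ∀ l, z l ∈ D) (hzr : IsDistalTuple f r z) {v : Fin n → X}
    (hv : ∀ l, v l ∈ stableClass f C D) {ε : ℝ} (hε : 0 < ε) :
    ∃ w : Fin n → X, (∀ l, w l ∈ stableClass f C D) ∧ (∀ l, dist (w l) (v l) ≤ ε) ∧
      sepSet f w (r / 2) ∈ familyUd1 ∧ ∀ η > 0, proxSet f w η ∈ familyUd1 := by
  obtain ⟨δ, hδ, hshadow⟩ := hs ε hε
  set l₀ : Fin n := ⟨0, by omega⟩
  obtain ⟨t, L, x, ht, hL, hx⟩ := exists_limitPseudoOrbits hf hC hD (hz l₀) hv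
    -- Even blocks will give separation, odd blocks proximity.
    (u := fun j => if Even j then z else fun _ => z l₀)
    (fun j l => by split_ifs <;> exact hz _) hδ
  choose w hw using fun l => hshadow (x l) (hx l).2.1
  have hwx : ∀ η > 0, ∀ᶠ j in atTop, ∀ i, ∀ l, dist (f^[t j + i] (w l)) (x l (t j + i)) < η := by
    intro η hη
    have h1 : ∀ᶠ m in atTop, ∀ l, dist (f^[m] (w l)) (x l m) < η :=
      eventually_all.2 fun l => (hw l).2.eventually_lt_const hη
    obtain ⟨M, hM⟩ := eventually_atTop.1 h1
    filter_upwards [ht.tendsto_atTop.eventually_ge_atTop M] with j hj i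
    exact hM _ (by omega)
  have heven : ∃ᶠ j in atTop, Even j :=
    frequently_atTop.2 fun a => ⟨2 * a, by omega, even_two_mul a⟩
  have hodd : ∃ᶠ j in atTop, ¬ Even j :=
    frequently_atTop.2 fun a => ⟨2 * a + 1, by omega, by simp⟩
  refine ⟨w, fun l => ?_, fun l => ?_, ?_, fun η hη => ?_⟩
  · have hnear : ∀ δ' > 0, Tendsto (fun i : ℕ => Metric.infDist (f^[i] (w l))
        (f^[i] '' {b ∈ C | CyclicRel f C δ' (z l₀) b})) atTop (𝓝 0) := fun δ' hδ' =>
      squeeze_zero' (Eventually.of_forall fun _ => Metric.infDist_nonneg)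
        (((hx l).2.2.2 δ' hδ').mono fun i hi => Metric.infDist_le_dist_of_mem hi) (hw l).2
    refine mem_stableClass_of_tendsto hC hD (hz l₀) ?_ hnear
    refine squeeze_zero' (Eventually.of_forall fun _ => Metric.infDist_nonneg)
      (((hx l).2.2.2 1 one_pos).mono fun i hi => Metric.infDist_le_dist_of_mem ?_) (hw l).2
    obtain ⟨b, hb, hbi⟩ := hi
    exact hbi ▸ hC.mapsTo.iterate i hb.1
  · have := (hw l).1 0
    rwa [(hx l).1] at this
  · refine mem_familyUd1_of_blocks ht hL ((heven.and_eventually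
      (hwx (r / 4) (by positivity))).mono fun j ⟨hj, hwj⟩ i hi => ?_)
    refine (lt_minDist_iff hn).2 fun l l' hll => ?_
    have h1 := hwj i l
    have h2 := hwj i l'
    rw [(hx _).2.2.1 j i hi, if_pos hj] at h1 h2
    have h3 := hzr.lt_dist i hll
    have h4 := dist_triangle4 (f^[i] (z l)) (f^[t j + i] (w l)) (f^[t j + i] (w l')) (f^[i] (z l'))
    rw [dist_comm (f^[i] (z l)) (f^[t j + i] (w l))] at h4
    linarith
  · refine mem_familyUd1_of_blocks ht hL ((hodd.and_eventually
      (hwx (η / 2) (by positivity))).mono fun j ⟨hj, hwj⟩ i hi => ?_)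
    refine (maxDist_lt_iff hn).2 fun l l' hll => ?_
    have h1 := hwj i l
    have h2 := hwj i l'
    rw [(hx _).2.2.1 j i hi, if_neg hj] at h1 h2
    have := dist_triangle_right (f^[t j + i] (w l)) (f^[t j + i] (w l')) (f^[i] (z l₀))
    linarith

end Construction

end SLimit

/-! ### The equivalences. -/

theorem theorem1p1 {X : Type*} [MetricSpace X] [CompactSpace X] (f : X → X)
    (hf : Continuous f) (hs : SLimit.SLimitShadowing f) (C : Set X)
    (hC : C ∈ SLimit.chainComponents f) (n : ℕ) (hn : 2 ≤ n) :
    List.TFAE [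
      ∃ D ∈ SLimit.proximalClasses f C, ∃ δ : ℝ, 0 < δ ∧
        ∃ x : Fin n → X, (∀ l, x l ∈ D) ∧ SLimit.IsDistalTuple f δ x,
      ∃ δ : ℝ, 0 < δ ∧ ∀ D ∈ SLimit.proximalClasses f C,
        ∃ x : Fin n → X, (∀ l, x l ∈ D) ∧ SLimit.IsDistalTuple f δ x,
      ∃ δ : ℝ, 0 < δ ∧ ∀ D ∈ SLimit.proximalClasses f C,
        (IsGδ {x : Fin n → SLimit.stableClass f C D |
            SLimit.sepSet f (fun l => (x l : X)) δ ∈ SLimit.familyUd1} ∧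
          Dense {x : Fin n → SLimit.stableClass f C D |
            SLimit.sepSet f (fun l => (x l : X)) δ ∈ SLimit.familyUd1}) ∧
        (IsGδ (⋂ (ε : ℝ) (_ : 0 < ε), {x : Fin n → SLimit.stableClass f C D |
            SLimit.proxSet f (fun l => (x l : X)) ε ∈ SLimit.familyUd1}) ∧
          Dense (⋂ (ε : ℝ) (_ : 0 < ε), {x : Fin n → SLimit.stableClass f C D |
            SLimit.proxSet f (fun l => (x l : X)) ε ∈ SLimit.familyUd1})),
      ∃ y : Fin n → X, (∀ l, y l ∈ SLimit.basin f C) ∧ ∃ δ : ℝ, 0 < δ ∧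
        SLimit.sepSet f y δ ∈ SLimit.familyThick ∧
        ∀ ε : ℝ, 0 < ε → SLimit.proxSet f y ε ∈ SLimit.familyInfinite] := by
  have hT := SLimit.chainTransitiveOn_of_mem_chainComponents hf hC
  obtain ⟨c, hc⟩ := hT.nonempty
  have hD₀ : {b ∈ C | SLimit.ChainProximal f C c b} ∈ SLimit.proximalClasses f C := ⟨c, hc, rfl⟩
  have hcD₀ : c ∈ {b ∈ C | SLimit.ChainProximal f C c b} := ⟨hc, fun δ hδ => hT.refl hδ hc⟩
  tfae_have 1 → 2 := by
    rintro ⟨D, hD, δ, hδ, x, hx, hdist⟩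
    exact ⟨δ / 2, by positivity, fun D' hD' =>
      SLimit.exists_distal_in_proximalClass hf hT hn hD hD' hδ hx hdist⟩
  tfae_have 2 → 3 := by
    rintro ⟨δ, hδ, h⟩
    refine ⟨δ / 2, by positivity, fun D hD => ?_⟩
    obtain ⟨z, hz, hzδ⟩ := h D hD
    have hcont : Continuous fun (x : Fin n → SLimit.stableClass f C D) l => (x l : X) := by
      fun_prop
    have happrox : ∀ (v : Fin n → SLimit.stableClass f C D), ∀ r > 0,
        ∃ w ∈ Metric.ball v r, SLimit.sepSet f (fun l => (w l : X)) (δ / 2) ∈ SLimit.familyUd1 ∧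
          ∀ η > 0, SLimit.proxSet f (fun l => (w l : X)) η ∈ SLimit.familyUd1 := fun v r hr => by
      obtain ⟨w, hw, hwv, h1, h2⟩ := SLimit.exists_chaotic_tuple hf hs hT hn hD hδ hz hzδ
        (fun l => (v l).2) (half_pos hr)
      refine ⟨fun l => ⟨w l, hw l⟩, ?_, h1, h2⟩
      rw [Metric.mem_ball, dist_pi_lt_iff hr]
      exact fun l => (hwv l).trans_lt (half_lt_self hr)
    refine ⟨⟨SLimit.isGδ_familyUd1 (SLimit.isOpen_mem_sepSet hf hn hcont _), ?_⟩,
      ⟨SLimit.isGδ_proxSet hf hn hcont, ?_⟩⟩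
    · refine Metric.dense_iff.2 fun v r hr => ?_
      obtain ⟨w, hw, h1, -⟩ := happrox v r hr
      exact ⟨w, hw, h1⟩
    · refine Metric.dense_iff.2 fun v r hr => ?_
      obtain ⟨w, hw, -, h2⟩ := happrox v r hr
      exact ⟨w, hw, Set.mem_iInter₂.2 h2⟩
  tfae_have 3 → 1 := by
    rintro ⟨δ, hδ, h⟩
    obtain ⟨⟨-, hdense⟩, -⟩ := h _ hD₀
    -- Density yields a point only in a nonempty space; the constant tuple at `c` provides this.
    have : Nonempty (Fin n → SLimit.stableClass f C {b ∈ C | SLimit.ChainProximal f C c b}) :=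
      ⟨fun _ => ⟨c, SLimit.subset_stableClass hT hD₀ hcD₀⟩⟩
    obtain ⟨y, hy⟩ := hdense.nonempty
    exact SLimit.exists_distal_of_stableClass hf hT hn hD₀ (fun l => (y l).2) hδ
      (SLimit.familyUd1_subset_familyThick hy)
  tfae_have 2 → 4 := by
    rintro ⟨δ, hδ, h⟩
    obtain ⟨z, hz, hzδ⟩ := h _ hD₀
    obtain ⟨w, hw, -, h1, h2⟩ := SLimit.exists_chaotic_tuple hf hs hT hn hD₀ hδ hz hzδ
      (v := fun _ => c) (fun _ => SLimit.subset_stableClass hT hD₀ hcD₀) one_pos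
    exact ⟨w, fun l => (hw l).1, δ / 2, by positivity, SLimit.familyUd1_subset_familyThick h1,
      fun ε hε => SLimit.familyThick_subset_familyInfinite
        (SLimit.familyUd1_subset_familyThick (h2 ε hε))⟩
  tfae_have 4 → 1 := by
    rintro ⟨y, hy, δ, hδ, hS, hprox⟩
    exact SLimit.exists_distal_of_basin hf hT hn hy hδ hS hprox
  tfae_finish
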